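/- Let $M$ be a smooth manifold of dimension $n\ge 2$ and let $g$, $\bar g$ be smooth Riemannian metrics on $M$ such that $\bar g$ is geodesically equivalent to $g$, i.e. every geodesic of $\bar g$, considered as an unparameterized curve, is a geodesic of $g$. Let $L$ be the $(1,1)$-tensor $$L^i_j=\left(\frac{\det(\bar g)}{\det(g)}\right)^{\frac1{n+1}}\bar g^{i\alpha}g_{\alpha j},$$ and for $t\in\mathbb R$ let $S_t=\det(L-t\,\mathrm{Id})\,(L-t\,\mathrm{Id})^{-1}$, where for $t$ in the spectrum of $L$ the tensor $S_t$ is defined by polynomial extension in $t$ (equivalently, $S_t$ is the adjugate of $L-t\,\mathrm{Id}$ for every $t$). Identify $TM$ with $T^*M$ by $v\mapsto g(v,\cdot)$ and transfer the canonical Poisson structure of $T^*M$ to $TM$. Then for every $t\in\mathbb R$ the function $$I_t:TM\to\mathbb R,\qquad I_t(v)=g(S_t(v),v),$$ is an integral of the geodesic flow of $g$ (it is smooth, and it is constant along the velocity curve of every geodesic of $g$), and for all $t_1,t_2\in\mathbb R$ the functions $I_{t_1}$ and $I_{t_2}$ Poisson-commute: $\{I_{t_1},I_{t_2}\}=0$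 on $TM$. -/

import Mathlib

open scoped Manifold ContDiff Topology

noncomputable section

namespace GeodesicEquivalence

/-- The model space `ℝⁿ`. -/
abbrev Model (n : ℕ) : Type := EuclideanSpace ℝ (Fin n)

section Defs

variable {n : ℕ} {M : Type*} [TopologicalSpace M] [ChartedSpace (Model n) M]

/-! ### Coordinates -/

/-- The coordinates given by the chart around `x₀`, as a map defined on all of `M` (it is
meaningful on the domain `(chartAt (Model n) x₀).source` of the chart). -/
abbrev coord (x₀ : M) (x : M) : Model n := extChartAt (𝓡 n) x₀ x

/-- The inverse of the coordinate map around `x₀` (meaningful on the image of the chart). -/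
abbrev coordInv (x₀ : M) (q : Model n) : M := (extChartAt (𝓡 n) x₀).symm q

/-- The differential at `x` of the coordinate map around `x₀`. -/
def dCoord (x₀ x : M) : TangentSpace (𝓡 n) x →L[ℝ] Model n :=
  mfderiv (𝓡 n) 𝓘(ℝ, Model n) (coord (n := n) x₀) x

/-- The differential of the inverse coordinate map at the coordinate point `q`: it sends
`u = (u₁, …, uₙ)` to the tangent vector `∑ uᵢ ∂/∂xᵢ` at the point with coordinates `q`. -/
def dCoordInv (x₀ : M) (q : Model n) :
    Model n →L[ℝ] TangentSpace (𝓡 n) (coordInv x₀ q) :=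
  mfderiv 𝓘(ℝ, Model n) (𝓡 n) (coordInv x₀) q

/-- A basis of `T_x M`: the coordinate vectors of the preferred chart around `x`. -/
def tangentBasis (x : M) : Module.Basis (Fin n) ℝ (TangentSpace (𝓡 n) x) :=
  (EuclideanSpace.basisFun (Fin n) ℝ).toBasis

variable [IsManifold (𝓡 n) ∞ M]

variable (n M) in
/-- Smooth Riemannian metrics on `M`. -/
abbrev Metric : Type _ :=
  Bundle.ContMDiffRiemannianMetric (𝓡 n) ∞ (Model n) (fun x : M ↦ TangentSpace (𝓡 n) x)

/-! ### Geodesics -/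

/-- The coefficients of the metric in the chart around `x₀`: the value of `g` at the point with
coordinates `q` on the tangent vectors with coordinates `u` and `v`. -/
def metricCoeff (g : Metric n M) (x₀ : M) (q u v : Model n) : ℝ :=
  g.inner (coordInv x₀ q) (dCoordInv x₀ q u) (dCoordInv x₀ q v)

/-- The Christoffel symbols of the first kind in the chart around `x₀`,
`½ (∂ᵤ g(v, w) + ∂ᵥ g(u, w) - ∂_w g(u, v))`. -/
def christoffel (g : Metric n M) (x₀ : M) (q u v w : Model n) : ℝ :=
  (fderiv ℝ (fun q' ↦ metricCoeff g x₀ q' v w) q u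
    + fderiv ℝ (fun q' ↦ metricCoeff g x₀ q' u w) q v
    - fderiv ℝ (fun q' ↦ metricCoeff g x₀ q' u v) q w) / 2

/-- A curve `γ`, defined on the open set `J ⊆ ℝ`, is a (parameterized) geodesic of `g`: it is `C²`
and, in local coordinates `c = (c₁, …, cₙ)`, it satisfies the geodesic equation
`g (c'' + Γ(c', c'), w) = 0` for every `w`. -/
structure IsGeodesicOn (g : Metric n M) (γ : ℝ → M) (J : Set ℝ) : Prop where
  contMDiffOn : ContMDiffOn 𝓘(ℝ, ℝ) (𝓡 n) 2 γ J
  geodesic_eq : ∀ t ∈ J, ∀ x₀ : M, γ t ∈ (chartAt (Model n) x₀).source →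
    ∀ w : Model n,
      metricCoeff g x₀ (coord x₀ (γ t)) (deriv (deriv (fun s ↦ coord x₀ (γ s))) t) w
        + christoffel g x₀ (coord x₀ (γ t)) (deriv (fun s ↦ coord x₀ (γ s)) t)
            (deriv (fun s ↦ coord x₀ (γ s)) t) w = 0

/-- `g'` is geodesically equivalent to `g`: every geodesic of `g'`, considered as an
unparameterized curve, is a geodesic of `g`. That is, every geodesic `γ : J → M` of `g'`, where `J`
is an open interval, becomes a geodesic of `g` after a change of parameter, i.e. after composition
with a `C²` bijection `τ : J' → J` of open intervals whose derivative does not vanish. -/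
def GeodesicallyEquivalent (g g' : Metric n M) : Prop :=
  ∀ (J : Set ℝ) (γ : ℝ → M), IsOpen J → J.OrdConnected → IsGeodesicOn g' γ J →
    ∃ (J' : Set ℝ) (τ : ℝ → ℝ), IsOpen J' ∧ J'.OrdConnected ∧ Set.BijOn τ J' J ∧
      ContDiffOn ℝ 2 τ J' ∧ (∀ s ∈ J', deriv τ s ≠ 0) ∧ IsGeodesicOn g (γ ∘ τ) J'

/-- The velocity of a curve, as a point of the tangent bundle. -/
def velocity (γ : ℝ → M) (t : ℝ) : TangentBundle (𝓡 n) M :=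
  ⟨γ t, mfderiv 𝓘(ℝ, ℝ) (𝓡 n) γ t (1 : ℝ)⟩

/-- `F : TM → ℝ` is an integral of the geodesic flow of `g`: it is smooth and constant on the orbits
of the flow, which are the velocity curves of the geodesics of `g`. -/
structure IsGeodesicIntegral (g : Metric n M) (F : TangentBundle (𝓡 n) M → ℝ) : Prop where
  contMDiff : ContMDiff (𝓡 n).tangent 𝓘(ℝ, ℝ) ∞ F
  const : ∀ (J : Set ℝ) (γ : ℝ → M), IsOpen J → J.OrdConnected → IsGeodesicOn g γ J →
    ∀ s ∈ J, ∀ t ∈ J, F (velocity γ s) = F (velocity γ t)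

/-! ### The Poisson structure -/

variable (n M) in
/-- The cotangent bundle of `M`. -/
abbrev CotangentBundle : Type _ :=
  Bundle.TotalSpace (Model n →L[ℝ] ℝ) (fun x : M ↦ TangentSpace (𝓡 n) x →L[ℝ] ℝ)

/-- The canonical coordinates `(q, p)` of a covector, in the chart around `x₀`. -/
def cotangentCoord (x₀ : M) (α : CotangentBundle n M) : Model n × (Model n →L[ℝ] ℝ) :=
  (coord x₀ α.proj, α.snd ∘L (ContinuousLinearMap.inverse (dCoord x₀ α.proj)))

/-- The covector with canonical coordinates `(q, p)`, i.e. `∑ pᵢ dxᵢ` at the point with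
coordinates `q`, in the chart around `x₀`. -/
def cotangentCoordInv (x₀ : M) (z : Model n × (Model n →L[ℝ] ℝ)) : CotangentBundle n M :=
  ⟨coordInv x₀ z.1, z.2 ∘L dCoord x₀ (coordInv x₀ z.1)⟩

/-- The partial derivative `∂f/∂qᵢ` of a function of the canonical coordinates. -/
def partialQ (f : Model n × (Model n →L[ℝ] ℝ) → ℝ) (i : Fin n)
    (z : Model n × (Model n →L[ℝ] ℝ)) : ℝ :=
  fderiv ℝ f z (EuclideanSpace.single i 1, 0)

/-- The partial derivative `∂f/∂pᵢ` of a function of the canonical coordinates. -/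
def partialP (f : Model n × (Model n →L[ℝ] ℝ) → ℝ) (i : Fin n)
    (z : Model n × (Model n →L[ℝ] ℝ)) : ℝ :=
  fderiv ℝ f z (0, EuclideanSpace.proj i)

/-- The canonical Poisson bracket on `T*M`, `{F, G} = ∑ᵢ (∂F/∂qᵢ ∂G/∂pᵢ - ∂F/∂pᵢ ∂G/∂qᵢ)`, in the
canonical coordinates given by the chart around `x₀`. -/
def cotangentBracket (x₀ : M) (F G : CotangentBundle n M → ℝ) (α : CotangentBundle n M) : ℝ :=
  ∑ i : Fin n,
    (partialQ (F ∘ cotangentCoordInv x₀) i (cotangentCoord x₀ α)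
        * partialP (G ∘ cotangentCoordInv x₀) i (cotangentCoord x₀ α)
      - partialP (F ∘ cotangentCoordInv x₀) i (cotangentCoord x₀ α)
        * partialQ (G ∘ cotangentCoordInv x₀) i (cotangentCoord x₀ α))

/-- The identification `TM → T*M`, `v ↦ g(v, ·)`. -/
def flat (g : Metric n M) (v : TangentBundle (𝓡 n) M) : CotangentBundle n M :=
  ⟨v.proj, g.inner v.proj v.snd⟩

/-- The inverse identification `T*M → TM`. -/
def sharp (g : Metric n M) (α : CotangentBundle n M) : TangentBundle (𝓡 n) M :=
  ⟨α.proj, (g.inner α.proj).inverse α.snd⟩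

/-- The functions `F, G : TM → ℝ` commute with respect to the Poisson structure transferred from
`T*M` to `TM` by `g`: their bracket vanishes on `TM`, in all charts. -/
def PoissonCommute (g : Metric n M) (F G : TangentBundle (𝓡 n) M → ℝ) : Prop :=
  ∀ (v : TangentBundle (𝓡 n) M) (x₀ : M), v.proj ∈ (chartAt (Model n) x₀).source →
    cotangentBracket x₀ (F ∘ sharp g) (G ∘ sharp g) (flat g v) = 0

/-! ### The integrals -/

/-- The matrix `(g_{ij})` of the metric at `x`. -/
def gram (g : Metric n M) (x : M) : Matrix (Fin n) (Fin n) ℝ :=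
  Matrix.of fun i j ↦ g.inner x (tangentBasis x i) (tangentBasis x j)

/-- The `(1,1)`-tensor `L = (det g' / det g)^{1/(n+1)} g'⁻¹ g`. -/
def tensorL (g g' : Metric n M) (x : M) :
    TangentSpace (𝓡 n) x →ₗ[ℝ] TangentSpace (𝓡 n) x :=
  ((gram g' x).det / (gram g x).det) ^ (1 / ((n : ℝ) + 1)) •
    ((g'.inner x).inverse ∘L g.inner x : TangentSpace (𝓡 n) x →L[ℝ] TangentSpace (𝓡 n) x)

/-- The `(1,1)`-tensor `S_t = det(L - t Id) (L - t Id)⁻¹`, defined for all real `t` as the adjugate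
of `L - t Id` (the polynomial extension in `t` of the formula). -/
def tensorS (g g' : Metric n M) (t : ℝ) (x : M) :
    TangentSpace (𝓡 n) x →ₗ[ℝ] TangentSpace (𝓡 n) x :=
  Matrix.toLin (tangentBasis x) (tangentBasis x)
    (LinearMap.toMatrix (tangentBasis x) (tangentBasis x)
      (tensorL g g' x - t • LinearMap.id)).adjugate

/-- The function `I_t(v) = g(S_t v, v)` on `TM`. -/
def integral (g g' : Metric n M) (t : ℝ) (v : TangentBundle (𝓡 n) M) : ℝ :=
  g.inner v.proj (tensorS g g' t v.proj v.snd) v.snd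

/-! ### Consistency of the definitions -/

/-- For `t` outside the spectrum of `L`, `S_t` is given by the formula
`det(L - t Id) (L - t Id)⁻¹`. -/
theorem tensorS_eq (g g' : Metric n M) (t : ℝ) (x : M)
    (e : TangentSpace (𝓡 n) x ≃ₗ[ℝ] TangentSpace (𝓡 n) x)
    (he : (e : TangentSpace (𝓡 n) x →ₗ[ℝ] TangentSpace (𝓡 n) x)
      = tensorL g g' x - t • LinearMap.id) :
    tensorS g g' t x = LinearMap.det (tensorL g g' x - t • LinearMap.id) •
      (e.symm : TangentSpace (𝓡 n) x →ₗ[ℝ] TangentSpace (𝓡 n) x) := by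
  set A := tensorL g g' x - t • LinearMap.id
  have h1 : tensorS g g' t x ∘ₗ A = LinearMap.det A • LinearMap.id := by
    apply (LinearMap.toMatrix (tangentBasis x) (tangentBasis x)).injective
    rw [LinearMap.toMatrix_comp _ (tangentBasis x), tensorS, LinearMap.toMatrix_toLin,
      Matrix.adjugate_mul, LinearMap.det_toMatrix, map_smul, LinearMap.toMatrix_id]
  ext v
  have h2 := LinearMap.congr_fun h1 (e.symm v)
  have h3 : A (e.symm v) = v := by
    rw [← he]; simp
  rw [LinearMap.comp_apply, h3] at h2
  simpa using h2

/-- A positive definite bilinear form on `ℝⁿ` is nondegenerate. -/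
theorem isInvertible_of_pos (B : Model n →L[ℝ] Model n →L[ℝ] ℝ)
    (hB : ∀ v, v ≠ 0 → 0 < B v v) : B.IsInvertible := by
  have hinj : Function.Injective B.toLinearMap := by
    rw [← LinearMap.ker_eq_bot, LinearMap.ker_eq_bot']
    intro v hv
    by_contra hne
    have h := hB v hne
    have h0 : B v = 0 := hv
    rw [h0] at h
    simp at h
  have hdim : Module.finrank ℝ (Model n) = Module.finrank ℝ (Model n →L[ℝ] ℝ) := by
    rw [← (LinearMap.toContinuousLinearMap (𝕜 := ℝ) (E := Model n) (F' := ℝ)).finrank_eq]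
    exact (Subspace.dual_finrank_eq (K := ℝ) (V := Model n)).symm
  exact ⟨(LinearMap.linearEquivOfInjective B.toLinearMap hinj hdim).toContinuousLinearEquiv,
    by ext; rfl⟩

/-- A Riemannian metric is nondegenerate: `v ↦ g(v, ·)` is invertible on each tangent space. -/
theorem isInvertible_inner (g : Metric n M) (x : M) : (g.inner x).IsInvertible :=
  isInvertible_of_pos (n := n) (g.inner x) (g.pos x)

theorem sharp_flat (g : Metric n M) (v : TangentBundle (𝓡 n) M) : sharp g (flat g v) = v := by
  obtain ⟨x, v⟩ := v
  have h := (isInvertible_inner g x).inverse_apply_eq (x := v) (y := g.inner x v)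
  exact congrArg (Bundle.TotalSpace.mk (F := Model n) x) (h.2 rfl)

theorem flat_sharp (g : Metric n M) (α : CotangentBundle n M) : flat g (sharp g α) = α := by
  obtain ⟨x, α⟩ := α
  have h := (isInvertible_inner g x).inverse_apply_eq (x := (g.inner x).inverse α) (y := α)
  exact congrArg (Bundle.TotalSpace.mk (F := Model n →L[ℝ] ℝ) x) (h.1 rfl).symm

end Defs

end GeodesicEquivalence

end

/-!
The argument is local. In a chart, let `Γ` and `Γ'` be the Christoffel symbols of `g` and `g'`,
seen as symmetric bilinear maps `(u, v) ↦ Γ(u, v)` on `ℝⁿ`.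

*From geodesics to connections.* Through every point there is a geodesic of `g'` with any
prescribed velocity `u` (`exists_isGeodesicOn`, by the existence theorem for ordinary differential
equations). It is a geodesic of `g` up to reparameterization, so comparing the two geodesic
equations at the point gives `Γ'(u, u) - Γ(u, u) = k(u) u`
(`GeodesicallyEquivalent.connectionMatrix_parallel`). A symmetric bilinear map with this property
is of the form `φ(u) v + φ(v) u` for a linear form `φ` (`exists_linear_of_parallel`). This is
Levi-Civita's relation, `GeodesicallyEquivalent.exists_connectionMatrix_eq`; it is only needed
pointwise, so `φ` is not required to depend smoothly on the point.

*From connections to `L`.* Metric compatibility of both connections turns Levi-Civita's relation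
into Sinjukov's equation `∇_w L = λ♯ ⊗ g(w, ·) + w ⊗ λ` with `λ = -L^* φ`
(`hasDerivAt_benentiMatrix`). The exponent `1 / (n + 1)` in the definition of `L` is what removes
the terms proportional to `L`.

*From `L` to the integrals.* For `t` outside the spectrum, put `A = L - t` and `S_t = det(A) A⁻¹`.
Since `A` is self-adjoint for `g`, Sinjukov's equation yields
`g((∇_w S_t) v, v) = 2 det(A) (λ(A⁻¹ w) g(A⁻¹ v, v) - g(A⁻¹ w, v) λ(A⁻¹ v))`
(`quadratic_adjugateDeriv_sinjukov`). For `w = v` the right-hand side vanishes, so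
that `I_t` is constant along geodesics (`hasDerivAt_integralForm`,
`isGeodesicIntegral_integral`). In canonical coordinates the bracket `{I_a, I_b}` is twice the
difference of `g((∇_w S_a) v, v)` for `w = S_b v` and the same expression with `a` and `b`
exchanged, because the connection is symmetric. The difference vanishes by the resolvent identity
for `(L - a)⁻¹` and `(L - b)⁻¹` (`quadratic_adjugateDeriv_comm`, `poissonCommute_integral`).

Values of `t` in the spectrum are reached by continuity, as the spectrum is finite
(`eq_of_eq_off_spectrum`).
-/

namespace GeodesicEquivalence

open scoped Matrix.Norms.Operator
open Matrix

/-! ### Differential calculus of determinants and inverses -/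

section MatrixCalculus
variable {n : ℕ}

/-- Matrices carry the operator norm only to make their normed-algebra structure available;
derivatives are entrywise, as for any norm. -/
theorem hasDerivAt_matrix_iff {M : ℝ → Matrix (Fin n) (Fin n) ℝ} {M' : Matrix (Fin n) (Fin n) ℝ}
    {s : ℝ} : HasDerivAt M M' s ↔ ∀ i j, HasDerivAt (fun r ↦ M r i j) (M' i j) s := by
  constructor
  · intro h i j
    exact ((Matrix.entryLinearMap ℝ ℝ i j).toContinuousLinearMap.hasFDerivAt
      (x := M s)).comp_hasDerivAt s h
  · intro h
    have h1 : HasDerivAt (fun r ↦ ∑ i, ∑ j, M r i j • Matrix.single i j (1 : ℝ))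
        (∑ i, ∑ j, M' i j • Matrix.single i j (1 : ℝ)) s :=
      HasDerivAt.fun_sum fun i _ ↦ HasDerivAt.fun_sum fun j _ ↦ (h i j).smul_const _
    have h2 : ∀ A : Matrix (Fin n) (Fin n) ℝ,
        ∑ i, ∑ j, A i j • Matrix.single i j (1 : ℝ) = A := by
      intro A
      conv_rhs => rw [Matrix.matrix_eq_sum_single A]
      simp [Matrix.smul_single]
    simpa only [h2] using h1

theorem contDiffOn_matrix_iff {E : Type*} [NormedAddCommGroup E] [NormedSpace ℝ E]
    {M : E → Matrix (Fin n) (Fin n) ℝ} {k : ℕ∞ω} {U : Set E} :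
    ContDiffOn ℝ k M U ↔ ∀ i j, ContDiffOn ℝ k (fun q ↦ M q i j) U := by
  constructor
  · intro h i j
    exact (Matrix.entryLinearMap ℝ ℝ i j).toContinuousLinearMap.contDiff.comp_contDiffOn h
  · intro h
    have h1 : ContDiffOn ℝ k (fun r ↦ ∑ i, ∑ j, M r i j • Matrix.single i j (1 : ℝ)) U :=
      ContDiffOn.sum fun i _ ↦ ContDiffOn.sum fun j _ ↦ (h i j).smul contDiffOn_const
    have h2 : ∀ A : Matrix (Fin n) (Fin n) ℝ,
        ∑ i, ∑ j, A i j • Matrix.single i j (1 : ℝ) = A := by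
      intro A
      conv_rhs => rw [Matrix.matrix_eq_sum_single A]
      simp [Matrix.smul_single]
    simpa only [h2] using h1

theorem contDiff_det : ContDiff ℝ ∞ (fun A : Matrix (Fin n) (Fin n) ℝ ↦ A.det) := by
  have h := (contDiffOn_matrix_iff (n := n) (k := ∞) (U := Set.univ)
    (M := fun A : Matrix (Fin n) (Fin n) ℝ ↦ A)).1 contDiffOn_id
  simp only [contDiffOn_univ] at h
  simp only [Matrix.det_apply]
  exact ContDiff.sum fun σ _ ↦ (contDiff_prod fun i _ ↦ h _ _).const_smul _

theorem contDiff_adjugate :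
    ContDiff ℝ ∞ (fun A : Matrix (Fin n) (Fin n) ℝ ↦ A.adjugate) := by
  rw [← contDiffOn_univ, contDiffOn_matrix_iff]
  intro i j
  simp only [Matrix.adjugate_apply]
  refine contDiff_det.comp_contDiffOn ?_
  rw [contDiffOn_matrix_iff]
  intro k l
  by_cases hk : k = j
  · subst hk
    simpa using contDiffOn_const
  · simp only [Matrix.updateRow_ne hk]
    exact contDiffOn_matrix_iff.1 contDiffOn_id _ _

/-- **Jacobi's formula** for the derivative of a determinant. -/
theorem hasDerivAt_det {M : ℝ → Matrix (Fin n) (Fin n) ℝ} {M' : Matrix (Fin n) (Fin n) ℝ}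
    {s : ℝ} (h : HasDerivAt M M' s) :
    HasDerivAt (fun r ↦ (M r).det) ((M s).adjugate * M').trace s := by
  rw [hasDerivAt_matrix_iff] at h
  have h1 : HasDerivAt (fun r ↦ ∑ σ : Equiv.Perm (Fin n), ((Equiv.Perm.sign σ : ℤ) : ℝ) *
      ∏ i, M r (σ i) i) (∑ σ : Equiv.Perm (Fin n), ((Equiv.Perm.sign σ : ℤ) : ℝ) *
        ∑ i, (∏ j ∈ Finset.univ.erase i, M s (σ j) j) • M' (σ i) i) s :=
    HasDerivAt.fun_sum fun σ _ ↦ (HasDerivAt.fun_finsetProd fun i _ ↦ h _ _).const_mul _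
  simp only [Matrix.det_apply']
  convert h1 using 1
  simp only [Matrix.trace, Matrix.diag]
  have h2 : ∀ i, ((M s).adjugate * M') i i
      = ∑ σ : Equiv.Perm (Fin n), ((Equiv.Perm.sign σ : ℤ) : ℝ) *
        ((∏ j ∈ Finset.univ.erase i, M s (σ j) j) • M' (σ i) i) := by
    intro i
    have h3 : ((M s).adjugate * M') i i = ((M s).updateCol i (fun k ↦ M' k i)).det := by
      rw [← Matrix.cramer_apply, Matrix.cramer_eq_adjugate_mulVec]
      rfl
    rw [h3, Matrix.det_apply']
    refine Finset.sum_congr rfl fun σ _ ↦ ?_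
    rw [← Finset.prod_erase_mul _ _ (Finset.mem_univ i)]
    congr 2
    · refine Finset.prod_congr rfl fun j hj ↦ ?_
      rw [Matrix.updateCol_ne (Finset.ne_of_mem_erase hj)]
    · rw [Matrix.updateCol_self]
  simp only [h2, Finset.mul_sum]
  exact Finset.sum_comm

theorem hasDerivAt_matrix_inv {M : ℝ → Matrix (Fin n) (Fin n) ℝ}
    {M' : Matrix (Fin n) (Fin n) ℝ} {s : ℝ} (h : HasDerivAt M M' s) (hd : (M s).det ≠ 0) :
    HasDerivAt (fun r ↦ (M r)⁻¹) (-((M s)⁻¹ * M' * (M s)⁻¹)) s := by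
  have hu : IsUnit (M s) := (Matrix.isUnit_iff_isUnit_det _).2 hd.isUnit
  obtain ⟨u, hu⟩ := hu
  have h1 := hasFDerivAt_ringInverse (𝕜 := ℝ) u
  rw [hu] at h1
  have h2 := h1.comp_hasDerivAt s h
  have h3 : ((u⁻¹ : (Matrix (Fin n) (Fin n) ℝ)ˣ) : Matrix (Fin n) (Fin n) ℝ) = (M s)⁻¹ := by
    rw [Matrix.coe_units_inv, hu]
  have h4 : (-ContinuousLinearMap.mulLeftRight ℝ (Matrix (Fin n) (Fin n) ℝ)
      ((u⁻¹ : (Matrix (Fin n) (Fin n) ℝ)ˣ) : Matrix (Fin n) (Fin n) ℝ)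
      ((u⁻¹ : (Matrix (Fin n) (Fin n) ℝ)ˣ) : Matrix (Fin n) (Fin n) ℝ)) M'
      = -((M s)⁻¹ * M' * (M s)⁻¹) := by
    simp [h3]
  rw [h4] at h2
  simp only [Function.comp_def, ← Matrix.nonsing_inv_eq_ringInverse] at h2
  exact h2

theorem contDiffAt_matrix_inv {A : Matrix (Fin n) (Fin n) ℝ} (hd : A.det ≠ 0) :
    ContDiffAt ℝ ∞ (fun B : Matrix (Fin n) (Fin n) ℝ ↦ B⁻¹) A := by
  obtain ⟨u, hu⟩ := (Matrix.isUnit_iff_isUnit_det _).2 hd.isUnit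
  have h := contDiffAt_ringInverse ℝ (n := ∞) u
  rw [hu] at h
  have h1 : (fun B : Matrix (Fin n) (Fin n) ℝ ↦ B⁻¹) = Ring.inverse :=
    funext fun B ↦ Matrix.nonsing_inv_eq_ringInverse B
  rw [h1]
  exact h

/-- Two continuous functions of `t` agree if they agree for `t` outside the spectrum of `A`. -/
theorem eq_of_eq_off_spectrum (A : Matrix (Fin n) (Fin n) ℝ) {X : Type*} [TopologicalSpace X]
    [T2Space X] {f g : ℝ → X} (hf : Continuous f) (hg : Continuous g)
    (h : ∀ t, (A - t • (1 : Matrix (Fin n) (Fin n) ℝ)).det ≠ 0 → f t = g t) : f = g := by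
  have hfin : {t : ℝ | (A - t • (1 : Matrix (Fin n) (Fin n) ℝ)).det = 0}.Finite := by
    -- The spectrum is the set of roots of the characteristic polynomial.
    refine (A.charpoly.roots.toFinset.finite_toSet).subset fun t ht ↦ ?_
    have hc : A.charpoly ≠ 0 := A.charpoly_monic.ne_zero
    simp only [Finset.mem_coe, Multiset.mem_toFinset, Polynomial.mem_roots hc,
      Polynomial.IsRoot.def, Matrix.eval_charpoly]
    have h1 : Matrix.scalar (Fin n) t - A = -(A - t • (1 : Matrix (Fin n) (Fin n) ℝ)) := by
      rw [neg_sub, Matrix.smul_one_eq_diagonal]; rfl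
    rw [h1, Matrix.det_neg, Set.mem_ofPred.1 ht, mul_zero]
  refine Continuous.ext_on (hfin.countable.dense_compl ℝ) hf hg fun t ht ↦ h t ht

end MatrixCalculus

/-! ### The derivative of the adjugate -/

section AdjugateDerivative
variable {n : ℕ}

/-- The derivative of the adjugate at the matrix `A` in the direction `H`. -/
noncomputable def adjugateDeriv (A H : Matrix (Fin n) (Fin n) ℝ) : Matrix (Fin n) (Fin n) ℝ :=
  fderiv ℝ (fun B : Matrix (Fin n) (Fin n) ℝ ↦ B.adjugate) A H

theorem adjugateDeriv_add (A H K : Matrix (Fin n) (Fin n) ℝ) :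
    adjugateDeriv A (H + K) = adjugateDeriv A H + adjugateDeriv A K :=
  map_add _ _ _

theorem hasDerivAt_adjugate {A : ℝ → Matrix (Fin n) (Fin n) ℝ} {A' : Matrix (Fin n) (Fin n) ℝ}
    {s : ℝ} (h : HasDerivAt A A' s) :
    HasDerivAt (fun r ↦ (A r).adjugate) (adjugateDeriv (A s) A') s :=
  ((contDiff_adjugate.differentiable (by simp)) (A s)).hasFDerivAt.comp_hasDerivAt s h

theorem continuous_adjugateDeriv :
    Continuous fun p : Matrix (Fin n) (Fin n) ℝ × Matrix (Fin n) (Fin n) ℝ ↦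
      adjugateDeriv p.1 p.2 :=
  contDiff_adjugate.continuous_fderiv_apply (by simp)

theorem adjugate_eq_det_smul_inv {A : Matrix (Fin n) (Fin n) ℝ} (hA : A.det ≠ 0) :
    A.adjugate = A.det • A⁻¹ := by
  rw [Matrix.inv_def, smul_smul, Ring.inverse_eq_inv', mul_inv_cancel₀ hA, one_smul]

/-- The derivative of `det(A) A⁻¹`, for invertible `A`. -/
theorem adjugateDeriv_of_det_ne_zero {A : Matrix (Fin n) (Fin n) ℝ} (hA : A.det ≠ 0)
    (H : Matrix (Fin n) (Fin n) ℝ) :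
    adjugateDeriv A H = A.det • ((A⁻¹ * H).trace • A⁻¹ - A⁻¹ * H * A⁻¹) := by
  have hl : HasDerivAt (fun r : ℝ ↦ A + r • H) H 0 := by
    have h := ((hasDerivAt_id (0 : ℝ)).smul_const H).const_add A
    rwa [one_smul] at h
  have h0 : A + (0 : ℝ) • H = A := by simp
  have h1 := hasDerivAt_adjugate hl
  have h2 := (hasDerivAt_det hl).smul (hasDerivAt_matrix_inv hl (by rwa [h0]))
  have h3 : (fun r : ℝ ↦ (A + r • H).adjugate) =ᶠ[𝓝 0]
      (fun r : ℝ ↦ (A + r • H).det • (A + r • H)⁻¹) := by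
    have hc : ContinuousAt (fun r : ℝ ↦ (A + r • H).det) 0 := (hasDerivAt_det hl).continuousAt
    filter_upwards [hc.eventually_ne (by simpa using hA)] with r hr
    exact adjugate_eq_det_smul_inv hr
  have h4 := h1.unique (h2.congr_of_eventuallyEq h3)
  rw [h0] at h4
  rw [h4, adjugate_eq_det_smul_inv hA, Matrix.smul_mul, Matrix.trace_smul, smul_sub, smul_neg,
    smul_smul, smul_eq_mul]
  abel

theorem continuous_sub_smul_one (L : Matrix (Fin n) (Fin n) ℝ) :
    Continuous fun t : ℝ ↦ L - t • (1 : Matrix (Fin n) (Fin n) ℝ) := by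
  fun_prop

/-- The adjugate is equivariant under conjugation, infinitesimally. -/
theorem adjugateDeriv_commutator (A C : Matrix (Fin n) (Fin n) ℝ) :
    adjugateDeriv A (A * C - C * A) = A.adjugate * C - C * A.adjugate := by
  have hc := continuous_sub_smul_one A
  have h := eq_of_eq_off_spectrum A
    (f := fun t ↦ adjugateDeriv (A - t • 1) ((A - t • 1) * C - C * (A - t • 1)))
    (g := fun t ↦ (A - t • (1 : Matrix (Fin n) (Fin n) ℝ)).adjugate * C
      - C * (A - t • (1 : Matrix (Fin n) (Fin n) ℝ)).adjugate)
    (continuous_adjugateDeriv.comp (hc.prodMk (by fun_prop)))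
    (by fun_prop) ?_
  · simpa using congrFun h 0
  · intro t ht
    generalize A - t • (1 : Matrix (Fin n) (Fin n) ℝ) = B at ht
    have hl : B⁻¹ * B = 1 := Matrix.nonsing_inv_mul _ ht.isUnit
    have hr : B * B⁻¹ = 1 := Matrix.mul_nonsing_inv _ ht.isUnit
    have htr : (B⁻¹ * (B * C - C * B)).trace = 0 := by
      rw [mul_sub, Matrix.trace_sub, ← mul_assoc, hl, one_mul, ← mul_assoc, Matrix.trace_mul_comm,
        ← mul_assoc, hr, one_mul, sub_self]
    have h1 : B⁻¹ * (B * C - C * B) * B⁻¹ = C * B⁻¹ - B⁻¹ * C := by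
      rw [mul_sub, ← mul_assoc, hl, one_mul, sub_mul, mul_assoc, mul_assoc, hr, mul_one]
    rw [adjugateDeriv_of_det_ne_zero ht, htr, h1, adjugate_eq_det_smul_inv ht, zero_smul, zero_sub,
      neg_sub, smul_sub, Matrix.smul_mul, Matrix.mul_smul]

end AdjugateDerivative

/-! ### Quadratic forms along Sinjukov's direction -/

section SinjukovAlgebra
variable {n : ℕ}

/-- The covariant derivative in the direction `w` of a tensor `L` satisfying Sinjukov's equation
`∇_w L = λ♯ ⊗ g(w, ·) + w ⊗ λ`, where `g` is the metric with matrix `G`. -/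
noncomputable def sinjukov (G : Matrix (Fin n) (Fin n) ℝ) (l w : Fin n → ℝ) :
    Matrix (Fin n) (Fin n) ℝ :=
  vecMulVec (G⁻¹ *ᵥ l) (G *ᵥ w) + vecMulVec w l

theorem continuous_sinjukov (G : Matrix (Fin n) (Fin n) ℝ) (l : Fin n → ℝ) :
    Continuous (sinjukov G l) := by
  unfold sinjukov
  fun_prop

/-- A self-adjoint operator moves across the scalar product. -/
theorem dotProduct_mulVec_of_selfAdjoint {G K : Matrix (Fin n) (Fin n) ℝ} (hG : Gᵀ = G)
    (hK : (G * K)ᵀ = G * K) (x y : Fin n → ℝ) :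
    x ⬝ᵥ (G *ᵥ (K *ᵥ y)) = (K *ᵥ x) ⬝ᵥ (G *ᵥ y) := by
  have h : G * K = Kᵀ * G := by rw [← hK, Matrix.transpose_mul, hG]
  rw [Matrix.mulVec_mulVec, h, ← Matrix.mulVec_mulVec, Matrix.dotProduct_mulVec,
    Matrix.vecMul_transpose]

theorem dotProduct_mulVec_symm {G : Matrix (Fin n) (Fin n) ℝ} (hG : Gᵀ = G) (x y : Fin n → ℝ) :
    x ⬝ᵥ (G *ᵥ y) = y ⬝ᵥ (G *ᵥ x) := by
  rw [Matrix.dotProduct_mulVec, ← Matrix.mulVec_transpose, hG, dotProduct_comm]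

theorem selfAdjoint_inv {G A : Matrix (Fin n) (Fin n) ℝ} (hG : Gᵀ = G) (hA : A.det ≠ 0)
    (hGA : (G * A)ᵀ = G * A) : (G * A⁻¹)ᵀ = G * A⁻¹ := by
  have hl : A⁻¹ * A = 1 := Matrix.nonsing_inv_mul _ hA.isUnit
  have hr : A * A⁻¹ = 1 := Matrix.mul_nonsing_inv _ hA.isUnit
  have h : Aᵀ * G = G * A := by rw [← hGA, Matrix.transpose_mul, hG]
  rw [Matrix.transpose_mul, hG]
  calc (A⁻¹)ᵀ * G = (A⁻¹)ᵀ * (G * A) * A⁻¹ := by rw [mul_assoc, mul_assoc, hr, mul_one]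
    _ = (A⁻¹)ᵀ * Aᵀ * G * A⁻¹ := by rw [← h]; simp only [mul_assoc]
    _ = G * A⁻¹ := by rw [← Matrix.transpose_mul, hr, Matrix.transpose_one, one_mul]

theorem selfAdjoint_sub {G L : Matrix (Fin n) (Fin n) ℝ} (hG : Gᵀ = G)
    (hGL : (G * L)ᵀ = G * L) (t : ℝ) :
    (G * (L - t • (1 : Matrix (Fin n) (Fin n) ℝ)))ᵀ
      = G * (L - t • (1 : Matrix (Fin n) (Fin n) ℝ)) := by
  rw [mul_sub, Matrix.transpose_sub, hGL, Matrix.mul_smul, mul_one, Matrix.transpose_smul, hG]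

/-- The derivative of the quadratic form `g(adj(A) v, v)` along Sinjukov's direction, for
invertible `A`. -/
theorem quadratic_adjugateDeriv_sinjukov {G A : Matrix (Fin n) (Fin n) ℝ} (hG : Gᵀ = G)
    (hGd : G.det ≠ 0) (hA : A.det ≠ 0) (hGA : (G * A)ᵀ = G * A) (l w v : Fin n → ℝ) :
    (adjugateDeriv A (sinjukov G l w) *ᵥ v) ⬝ᵥ (G *ᵥ v)
      = 2 * A.det * ((l ⬝ᵥ (A⁻¹ *ᵥ w)) * ((A⁻¹ *ᵥ v) ⬝ᵥ (G *ᵥ v))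
          - ((A⁻¹ *ᵥ w) ⬝ᵥ (G *ᵥ v)) * (l ⬝ᵥ (A⁻¹ *ᵥ v))) := by
  have hK := selfAdjoint_inv hG hA hGA
  have hr : G * G⁻¹ = 1 := Matrix.mul_nonsing_inv _ hGd.isUnit
  have key : ∀ z : Fin n → ℝ, (A⁻¹ *ᵥ (G⁻¹ *ᵥ l)) ⬝ᵥ (G *ᵥ z) = l ⬝ᵥ (A⁻¹ *ᵥ z) := by
    intro z
    rw [← dotProduct_mulVec_of_selfAdjoint hG hK, dotProduct_mulVec_symm hG, Matrix.mulVec_mulVec,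
      hr, Matrix.one_mulVec, dotProduct_comm]
  have h1 : (A⁻¹ * sinjukov G l w).trace = 2 * (l ⬝ᵥ (A⁻¹ *ᵥ w)) := by
    rw [sinjukov, mul_add, Matrix.trace_add, Matrix.mul_vecMulVec, Matrix.mul_vecMulVec,
      Matrix.trace_vecMulVec, Matrix.trace_vecMulVec, key, dotProduct_comm _ l]
    ring
  have h2 : (A⁻¹ * sinjukov G l w * A⁻¹) *ᵥ v
      = ((A⁻¹ *ᵥ w) ⬝ᵥ (G *ᵥ v)) • (A⁻¹ *ᵥ (G⁻¹ *ᵥ l)) + (l ⬝ᵥ (A⁻¹ *ᵥ v)) • (A⁻¹ *ᵥ w) := by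
    rw [← Matrix.mulVec_mulVec, ← Matrix.mulVec_mulVec, sinjukov, Matrix.add_mulVec,
      Matrix.mulVec_add, Matrix.vecMulVec_mulVec, Matrix.vecMulVec_mulVec]
    simp only [op_smul_eq_smul, Matrix.mulVec_smul]
    rw [← dotProduct_mulVec_of_selfAdjoint hG hK w, dotProduct_comm (G *ᵥ w),
      dotProduct_mulVec_symm hG]
  rw [adjugateDeriv_of_det_ne_zero hA, h1, Matrix.smul_mulVec, Matrix.sub_mulVec, h2,
    Matrix.smul_mulVec]
  simp only [smul_dotProduct, sub_dotProduct, add_dotProduct, key, smul_eq_mul]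
  ring

/-- The tensor `∇S_t`, applied three times to the same vector, vanishes. -/
theorem quadratic_adjugateDeriv_self {G L : Matrix (Fin n) (Fin n) ℝ} (hG : Gᵀ = G)
    (hGd : G.det ≠ 0) (hGL : (G * L)ᵀ = G * L) (t : ℝ) (l v : Fin n → ℝ) :
    (adjugateDeriv (L - t • 1) (sinjukov G l v) *ᵥ v) ⬝ᵥ (G *ᵥ v) = 0 := by
  have hc := continuous_sub_smul_one L
  have h := eq_of_eq_off_spectrum L
    (f := fun t ↦ (adjugateDeriv (L - t • 1) (sinjukov G l v) *ᵥ v) ⬝ᵥ (G *ᵥ v))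
    (g := fun _ ↦ 0)
    (((continuous_adjugateDeriv.comp (hc.prodMk continuous_const)).matrix_mulVec
      continuous_const).dotProduct continuous_const) continuous_const ?_
  · exact congrFun h t
  · intro t ht
    rw [quadratic_adjugateDeriv_sinjukov hG hGd ht (selfAdjoint_sub hG hGL t)]
    ring

/-- The symmetry of the derivatives of `S_a` and `S_b` behind the commutation of the integrals. It
rests on the resolvent identity for `(L - a)⁻¹` and `(L - b)⁻¹`. -/
theorem quadratic_adjugateDeriv_comm {G L : Matrix (Fin n) (Fin n) ℝ} (hG : Gᵀ = G)
    (hGd : G.det ≠ 0) (hGL : (G * L)ᵀ = G * L) (a b : ℝ) (l v : Fin n → ℝ) :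
    (adjugateDeriv (L - a • 1) (sinjukov G l ((L - b • 1).adjugate *ᵥ v)) *ᵥ v) ⬝ᵥ (G *ᵥ v)
      = (adjugateDeriv (L - b • 1) (sinjukov G l ((L - a • 1).adjugate *ᵥ v)) *ᵥ v)
          ⬝ᵥ (G *ᵥ v) := by
  have hc := continuous_sub_smul_one L
  have hs := continuous_sinjukov G l
  have hf : ∀ {x y : ℝ → Matrix (Fin n) (Fin n) ℝ}, Continuous x → Continuous y →
      Continuous fun t ↦ (adjugateDeriv (x t) (sinjukov G l ((y t).adjugate *ᵥ v)) *ᵥ v)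
        ⬝ᵥ (G *ᵥ v) := fun hx hy ↦
    ((continuous_adjugateDeriv.comp (hx.prodMk (hs.comp
      (hy.matrix_adjugate.matrix_mulVec continuous_const)))).matrix_mulVec
      continuous_const).dotProduct continuous_const
  revert a
  refine congrFun (eq_of_eq_off_spectrum L (hf hc continuous_const) (hf continuous_const hc)
    fun a ha ↦ ?_)
  revert b
  refine congrFun (eq_of_eq_off_spectrum L (hf continuous_const hc) (hf hc continuous_const)
    fun b hb ↦ ?_)
  rw [quadratic_adjugateDeriv_sinjukov hG hGd ha (selfAdjoint_sub hG hGL a),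
    quadratic_adjugateDeriv_sinjukov hG hGd hb (selfAdjoint_sub hG hGL b),
    adjugate_eq_det_smul_inv ha, adjugate_eq_det_smul_inv hb]
  set A := L - a • (1 : Matrix (Fin n) (Fin n) ℝ) with hAdef
  set B := L - b • (1 : Matrix (Fin n) (Fin n) ℝ) with hBdef
  have hAl : A⁻¹ * A = 1 := Matrix.nonsing_inv_mul _ ha.isUnit
  have hAr : A * A⁻¹ = 1 := Matrix.mul_nonsing_inv _ ha.isUnit
  have hBl : B⁻¹ * B = 1 := Matrix.nonsing_inv_mul _ hb.isUnit
  have hBr : B * B⁻¹ = 1 := Matrix.mul_nonsing_inv _ hb.isUnit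
  have hBA : B - A = (a - b) • (1 : Matrix (Fin n) (Fin n) ℝ) := by
    rw [hAdef, hBdef, sub_smul]; abel
  have h1 : A⁻¹ - B⁻¹ = (a - b) • (A⁻¹ * B⁻¹) := by
    calc A⁻¹ - B⁻¹ = A⁻¹ * (B - A) * B⁻¹ := by
          rw [mul_sub, sub_mul, hAl, one_mul, mul_assoc, hBr, mul_one]
      _ = _ := by rw [hBA, Matrix.mul_smul, mul_one, Matrix.smul_mul]
  have h2 : A⁻¹ - B⁻¹ = (a - b) • (B⁻¹ * A⁻¹) := by
    calc A⁻¹ - B⁻¹ = B⁻¹ * (B - A) * A⁻¹ := by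
          rw [mul_sub, sub_mul, hBl, one_mul, mul_assoc, hAr, mul_one]
      _ = _ := by rw [hBA, Matrix.mul_smul, mul_one, Matrix.smul_mul]
  rcases eq_or_ne a b with hab | hab
  · subst hab; rfl
  -- The resolvents commute, by comparing the two forms of the resolvent identity.
  have h3 : A⁻¹ * B⁻¹ = B⁻¹ * A⁻¹ :=
    smul_right_injective _ (sub_ne_zero.2 hab) (h1.symm.trans h2)
  -- With `x = B⁻¹ A⁻¹ v`, both sides become polynomials in the pairings of `x` and `B⁻¹ v`.
  have h4 : A⁻¹ *ᵥ v = B⁻¹ *ᵥ v + (a - b) • (B⁻¹ *ᵥ (A⁻¹ *ᵥ v)) := by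
    rw [Matrix.mulVec_mulVec, ← Matrix.smul_mulVec, ← h2, Matrix.sub_mulVec]; abel
  simp only [Matrix.smul_mulVec, Matrix.mulVec_smul, dotProduct_smul, smul_dotProduct, smul_eq_mul]
  rw [Matrix.mulVec_mulVec (v := v) (M := A⁻¹) (N := B⁻¹), h3, ← Matrix.mulVec_mulVec]
  generalize B⁻¹ *ᵥ (A⁻¹ *ᵥ v) = x at h4 ⊢
  rw [h4]
  simp only [dotProduct_add, add_dotProduct, dotProduct_smul, smul_dotProduct, smul_eq_mul]
  ring

end SinjukovAlgebra

/-! ### Derivatives along curves of metrics -/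

section MetricCurves
variable {n : ℕ}

theorem hasDerivAt_mulVec {M : ℝ → Matrix (Fin n) (Fin n) ℝ} {M' : Matrix (Fin n) (Fin n) ℝ}
    {u : ℝ → Fin n → ℝ} {u' : Fin n → ℝ} {s : ℝ} (hM : HasDerivAt M M' s)
    (hu : HasDerivAt u u' s) :
    HasDerivAt (fun r ↦ M r *ᵥ u r) (M' *ᵥ u s + M s *ᵥ u') s := by
  rw [hasDerivAt_matrix_iff] at hM
  rw [hasDerivAt_pi] at hu ⊢
  intro i
  have h := HasDerivAt.fun_sum (u := Finset.univ) fun j _ ↦ (hM i j).mul (hu j)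
  rw [Finset.sum_add_distrib] at h
  exact h

theorem hasDerivAt_dotProduct {u v : ℝ → Fin n → ℝ} {u' v' : Fin n → ℝ} {s : ℝ}
    (hu : HasDerivAt u u' s) (hv : HasDerivAt v v' s) :
    HasDerivAt (fun r ↦ u r ⬝ᵥ v r) (u' ⬝ᵥ v s + u s ⬝ᵥ v') s := by
  rw [hasDerivAt_pi] at hu hv
  have h := HasDerivAt.fun_sum (u := Finset.univ) fun j _ ↦ (hu j).mul (hv j)
  rw [Finset.sum_add_distrib] at h
  exact h

/-- The matrix of the tensor `L = (det g' / det g)^{1/(n+1)} g'⁻¹ g`, for metrics with matrices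
`G` and `G'`. -/
noncomputable def benentiMatrix (G G' : Matrix (Fin n) (Fin n) ℝ) : Matrix (Fin n) (Fin n) ℝ :=
  (G'.det / G.det) ^ (1 / ((n : ℝ) + 1)) • (G'⁻¹ * G)

/-- The matrix of the tensor `S_t = adj(L - t)`. -/
noncomputable def adjugateMatrix (G G' : Matrix (Fin n) (Fin n) ℝ) (t : ℝ) :
    Matrix (Fin n) (Fin n) ℝ :=
  (benentiMatrix G G' - t • 1).adjugate

theorem selfAdjoint_benentiMatrix {G G' : Matrix (Fin n) (Fin n) ℝ} (hG : Gᵀ = G)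
    (hG' : G'ᵀ = G') : (G * benentiMatrix G G')ᵀ = G * benentiMatrix G G' := by
  rw [benentiMatrix, Matrix.mul_smul, Matrix.transpose_smul, Matrix.transpose_mul,
    Matrix.transpose_mul, Matrix.transpose_nonsing_inv, hG, hG', mul_assoc]

theorem selfAdjoint_adjugate {G A : Matrix (Fin n) (Fin n) ℝ} (hG : Gᵀ = G)
    (hGA : (G * A)ᵀ = G * A) : (G * A.adjugate)ᵀ = G * A.adjugate := by
  have hc := continuous_sub_smul_one A
  have h := eq_of_eq_off_spectrum A
    (f := fun t ↦ (G * (A - t • (1 : Matrix (Fin n) (Fin n) ℝ)).adjugate)ᵀ)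
    (g := fun t ↦ G * (A - t • (1 : Matrix (Fin n) (Fin n) ℝ)).adjugate)
    (by fun_prop) (by fun_prop) fun t ht ↦ ?_
  · simpa using congrFun h 0
  · rw [adjugate_eq_det_smul_inv ht, Matrix.mul_smul, Matrix.transpose_smul,
      selfAdjoint_inv hG ht (selfAdjoint_sub hG hGA t)]

theorem selfAdjoint_adjugateMatrix {G G' : Matrix (Fin n) (Fin n) ℝ} (hG : Gᵀ = G)
    (hG' : G'ᵀ = G') (t : ℝ) :
    (G * adjugateMatrix G G' t)ᵀ = G * adjugateMatrix G G' t :=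
  selfAdjoint_adjugate hG (selfAdjoint_sub hG (selfAdjoint_benentiMatrix hG hG') t)

/-- The logarithmic derivative of the determinant of a metric is twice the trace of the
connection. -/
theorem hasDerivAt_det_metric {G : ℝ → Matrix (Fin n) (Fin n) ℝ} {C : Matrix (Fin n) (Fin n) ℝ}
    {s : ℝ} (hG : HasDerivAt G (Cᵀ * G s + G s * C) s) :
    HasDerivAt (fun r ↦ (G r).det) ((G s).det * (2 * C.trace)) s := by
  convert hasDerivAt_det hG using 1
  rw [mul_add, Matrix.trace_add, ← mul_assoc (G s).adjugate (G s), Matrix.adjugate_mul,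
    Matrix.trace_mul_comm, mul_assoc, Matrix.mul_adjugate, Matrix.smul_mul, Matrix.mul_smul,
    one_mul, mul_one, Matrix.trace_smul, Matrix.trace_smul, Matrix.trace_transpose, smul_eq_mul]
  ring

/-- **Sinjukov's equation.** Along a curve with velocity `w`, let the connections of the metrics
`G` and `G'` be `C` and `C + φ(w) Id + w ⊗ φ`. Then the covariant derivative of `L` is
`λ♯ ⊗ g(w, ·) + w ⊗ λ` with `λ = -L^* φ`. -/
theorem hasDerivAt_benentiMatrix {G G' : ℝ → Matrix (Fin n) (Fin n) ℝ}
    {C C' : Matrix (Fin n) (Fin n) ℝ} {s : ℝ} {φ w : Fin n → ℝ}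
    (hG : HasDerivAt G (Cᵀ * G s + G s * C) s)
    (hG' : HasDerivAt G' (C'ᵀ * G' s + G' s * C') s)
    (hC : C' = C + (φ ⬝ᵥ w) • (1 : Matrix (Fin n) (Fin n) ℝ) + vecMulVec w φ)
    (hsG : (G s)ᵀ = G s) (hsG' : (G' s)ᵀ = G' s)
    (hd : 0 < (G s).det) (hd' : 0 < (G' s).det) :
    HasDerivAt (fun r ↦ benentiMatrix (G r) (G' r))
      (benentiMatrix (G s) (G' s) * C - C * benentiMatrix (G s) (G' s)
        + sinjukov (G s) (-((benentiMatrix (G s) (G' s))ᵀ *ᵥ φ)) w) s := by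
  have hn : (n : ℝ) + 1 ≠ 0 := by positivity
  have htr : C'.trace = C.trace + ((n : ℝ) + 1) * (φ ⬝ᵥ w) := by
    rw [hC, Matrix.trace_add, Matrix.trace_add, Matrix.trace_smul, Matrix.trace_one,
      Matrix.trace_vecMulVec, dotProduct_comm w φ, Fintype.card_fin, smul_eq_mul]
    ring
  set ρ : ℝ → ℝ := fun r ↦ (G' r).det / (G r).det with hρ
  have hρ0 : ρ s ≠ 0 := (div_pos hd' hd).ne'
  -- The traces of the connections differ by `(n + 1) φ(w)`; the exponent `1 / (n + 1)` turns this
  -- into `2 φ(w)`, which cancels the two terms `φ(w) Id` coming from the inverse of `G'`.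
  have h1 : HasDerivAt ρ (ρ s * (2 * ((n : ℝ) + 1) * (φ ⬝ᵥ w))) s := by
    refine ((hasDerivAt_det_metric hG').div (hasDerivAt_det_metric hG) hd.ne').congr_deriv ?_
    rw [htr, hρ]
    field_simp
    ring
  have h2 : HasDerivAt (fun r ↦ ρ r ^ (1 / ((n : ℝ) + 1)))
      (2 * (φ ⬝ᵥ w) * ρ s ^ (1 / ((n : ℝ) + 1))) s := by
    refine (h1.rpow_const (p := 1 / ((n : ℝ) + 1)) (Or.inl hρ0)).congr_deriv ?_
    rw [Real.rpow_sub_one hρ0]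
    field_simp
  have h3 := h2.smul ((hasDerivAt_matrix_inv hG' hd'.ne').mul hG)
  refine h3.congr_deriv ?_
  have hl : (G' s)⁻¹ * G' s = 1 := Matrix.nonsing_inv_mul _ hd'.ne'.isUnit
  have hr : G' s * (G' s)⁻¹ = 1 := Matrix.mul_nonsing_inv _ hd'.ne'.isUnit
  have hGl : (G s)⁻¹ * G s = 1 := Matrix.nonsing_inv_mul _ hd.ne'.isUnit
  set c := ρ s ^ (1 / ((n : ℝ) + 1)) with hc
  have hL : benentiMatrix (G s) (G' s) = c • ((G' s)⁻¹ * G s) := rfl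
  have hLt : (benentiMatrix (G s) (G' s))ᵀ = c • (G s * (G' s)⁻¹) := by
    rw [hL, Matrix.transpose_smul, Matrix.transpose_mul, Matrix.transpose_nonsing_inv, hsG, hsG']
  have h4 : vecMulVec ((G s)⁻¹ *ᵥ (-((benentiMatrix (G s) (G' s))ᵀ *ᵥ φ))) (G s *ᵥ w)
      = -(c • ((G' s)⁻¹ * vecMulVec φ w * G s)) := by
    rw [hLt, Matrix.mulVec_neg, Matrix.smul_mulVec, Matrix.mulVec_smul, Matrix.mulVec_mulVec,
      ← mul_assoc, hGl, one_mul, Matrix.neg_vecMulVec, Matrix.smul_vecMulVec,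
      Matrix.mul_vecMulVec, Matrix.vecMulVec_mul, ← Matrix.mulVec_transpose (G s) w, hsG]
  have h5 : vecMulVec w (-((benentiMatrix (G s) (G' s))ᵀ *ᵥ φ))
      = -(c • (vecMulVec w φ * ((G' s)⁻¹ * G s))) := by
    rw [Matrix.mulVec_transpose, Matrix.vecMulVec_neg, ← Matrix.vecMulVec_mul, hL, Matrix.mul_smul]
  have h6 : C'ᵀ = Cᵀ + (φ ⬝ᵥ w) • (1 : Matrix (Fin n) (Fin n) ℝ) + vecMulVec φ w := by
    rw [hC, Matrix.transpose_add, Matrix.transpose_add, Matrix.transpose_smul,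
      Matrix.transpose_one, Matrix.transpose_vecMulVec]
  have h7 : (G' s)⁻¹ * (C'ᵀ * G' s + G' s * C') * (G' s)⁻¹ = (G' s)⁻¹ * C'ᵀ + C' * (G' s)⁻¹ := by
    rw [mul_add, add_mul, ← mul_assoc, ← mul_assoc, hl, one_mul, mul_assoc _ (G' s), hr, mul_one]
  rw [sinjukov, h4, h5, hL, h7, h6, hC, Pi.mul_apply]
  generalize (φ ⬝ᵥ w) = f
  generalize (G' s)⁻¹ = P
  simp only [mul_add, add_mul, Matrix.mul_smul, Matrix.smul_mul, mul_one, one_mul, mul_assoc,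
    smul_add, neg_mul, smul_neg, neg_add_rev, smul_smul]
  module

/-- The derivative of `S_t`: the connection part is a commutator. -/
theorem hasDerivAt_adjugateMatrix {G G' : ℝ → Matrix (Fin n) (Fin n) ℝ}
    {C H : Matrix (Fin n) (Fin n) ℝ} {s : ℝ} (t : ℝ)
    (hL : HasDerivAt (fun r ↦ benentiMatrix (G r) (G' r))
      (benentiMatrix (G s) (G' s) * C - C * benentiMatrix (G s) (G' s) + H) s) :
    HasDerivAt (fun r ↦ adjugateMatrix (G r) (G' r) t)
      (adjugateMatrix (G s) (G' s) t * C - C * adjugateMatrix (G s) (G' s) t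
        + adjugateDeriv (benentiMatrix (G s) (G' s) - t • 1) H) s := by
  have h := hasDerivAt_adjugate (hL.sub_const (t • (1 : Matrix (Fin n) (Fin n) ℝ)))
  refine h.congr_deriv ?_
  rw [adjugateDeriv_add, adjugateMatrix, ← adjugateDeriv_commutator]
  congr 2
  rw [sub_mul, mul_sub, Matrix.smul_mul, Matrix.mul_smul, one_mul, mul_one]
  abel

/-- The value of `I_t` on the vector with coordinates `u`. -/
noncomputable def integralForm (G G' : Matrix (Fin n) (Fin n) ℝ) (t : ℝ) (u : Fin n → ℝ) : ℝ :=
  (adjugateMatrix G G' t *ᵥ u) ⬝ᵥ (G *ᵥ u)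

/-- Conservation of `I_t` along a curve `c` with velocity `u`, satisfying the geodesic equation
`u' = -Γ(c', u)`. -/
theorem hasDerivAt_integralForm {G G' : ℝ → Matrix (Fin n) (Fin n) ℝ}
    {C C' : Matrix (Fin n) (Fin n) ℝ} {s : ℝ} {φ : Fin n → ℝ} {u : ℝ → Fin n → ℝ}
    (hG : HasDerivAt G (Cᵀ * G s + G s * C) s)
    (hG' : HasDerivAt G' (C'ᵀ * G' s + G' s * C') s)
    (hC : C' = C + (φ ⬝ᵥ u s) • (1 : Matrix (Fin n) (Fin n) ℝ) + vecMulVec (u s) φ)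
    (hsG : (G s)ᵀ = G s) (hsG' : (G' s)ᵀ = G' s)
    (hd : 0 < (G s).det) (hd' : 0 < (G' s).det)
    (hu : HasDerivAt u (-(C *ᵥ u s)) s) (t : ℝ) :
    HasDerivAt (fun r ↦ integralForm (G r) (G' r) t (u r)) 0 s := by
  have hL := hasDerivAt_benentiMatrix hG hG' hC hsG hsG' hd hd'
  have hS := hasDerivAt_adjugateMatrix t hL
  have h := hasDerivAt_dotProduct (hasDerivAt_mulVec hS hu) (hasDerivAt_mulVec hG hu)
  refine h.congr_deriv ?_
  have hq := quadratic_adjugateDeriv_self hsG hd.ne' (selfAdjoint_benentiMatrix hsG hsG') t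
    (-((benentiMatrix (G s) (G' s))ᵀ *ᵥ φ)) (u s)
  have ht : (adjugateMatrix (G s) (G' s) t *ᵥ u s) ⬝ᵥ (Cᵀ *ᵥ (G s *ᵥ u s))
      = (C *ᵥ (adjugateMatrix (G s) (G' s) t *ᵥ u s)) ⬝ᵥ (G s *ᵥ u s) := by
    rw [Matrix.dotProduct_mulVec, Matrix.vecMul_transpose]
  simp only [Matrix.add_mulVec, Matrix.sub_mulVec, add_dotProduct, sub_dotProduct, hq,
    ← Matrix.mulVec_mulVec, dotProduct_add, ht, Matrix.mulVec_neg, neg_dotProduct, dotProduct_neg]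
  ring

/-- The derivative of the function `I_t` on covectors, at a fixed covector `p = g(v, ·)`. -/
theorem hasDerivAt_integralForm_covector {G G' : ℝ → Matrix (Fin n) (Fin n) ℝ}
    {C C' : Matrix (Fin n) (Fin n) ℝ} {s : ℝ} {φ w : Fin n → ℝ} {p v : Fin n → ℝ}
    (hG : HasDerivAt G (Cᵀ * G s + G s * C) s)
    (hG' : HasDerivAt G' (C'ᵀ * G' s + G' s * C') s)
    (hC : C' = C + (φ ⬝ᵥ w) • (1 : Matrix (Fin n) (Fin n) ℝ) + vecMulVec w φ)
    (hsG : (G s)ᵀ = G s) (hsG' : (G' s)ᵀ = G' s)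
    (hd : 0 < (G s).det) (hd' : 0 < (G' s).det)
    (hv : (G s)⁻¹ *ᵥ p = v) (t : ℝ) :
    HasDerivAt (fun r ↦ ((adjugateMatrix (G r) (G' r) t * (G r)⁻¹) *ᵥ p) ⬝ᵥ p)
      ((adjugateDeriv (benentiMatrix (G s) (G' s) - t • 1)
          (sinjukov (G s) (-((benentiMatrix (G s) (G' s))ᵀ *ᵥ φ)) w) *ᵥ v) ⬝ᵥ (G s *ᵥ v)
        - 2 * ((C *ᵥ (adjugateMatrix (G s) (G' s) t *ᵥ v)) ⬝ᵥ (G s *ᵥ v))) s := by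
  have hL := hasDerivAt_benentiMatrix hG hG' hC hsG hsG' hd hd'
  have hS := hasDerivAt_adjugateMatrix t hL
  have h := hasDerivAt_dotProduct (hasDerivAt_mulVec (hS.mul (hasDerivAt_matrix_inv hG hd.ne'))
    (hasDerivAt_const s p)) (hasDerivAt_const s p)
  refine h.congr_deriv ?_
  have hl : (G s)⁻¹ * G s = 1 := Matrix.nonsing_inv_mul _ hd.ne'.isUnit
  have hr : G s * (G s)⁻¹ = 1 := Matrix.mul_nonsing_inv _ hd.ne'.isUnit
  have hp : p = G s *ᵥ v := by rw [← hv, Matrix.mulVec_mulVec, hr, Matrix.one_mulVec]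
  have h7 : (G s)⁻¹ * (Cᵀ * G s + G s * C) * (G s)⁻¹ = (G s)⁻¹ * Cᵀ + C * (G s)⁻¹ := by
    rw [mul_add, add_mul, ← mul_assoc, ← mul_assoc, hl, one_mul, mul_assoc _ (G s), hr, mul_one]
  have ht : (adjugateMatrix (G s) (G' s) t *ᵥ ((G s)⁻¹ *ᵥ (Cᵀ *ᵥ p))) ⬝ᵥ p
      = (C *ᵥ (adjugateMatrix (G s) (G' s) t *ᵥ v)) ⬝ᵥ (G s *ᵥ v) := by
    nth_rewrite 2 [hp]
    rw [← dotProduct_mulVec_of_selfAdjoint hsG (selfAdjoint_adjugateMatrix hsG hsG' t),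
      dotProduct_mulVec_symm hsG, Matrix.mulVec_mulVec, hr, Matrix.one_mulVec,
      Matrix.dotProduct_mulVec, Matrix.vecMul_transpose, hp]
  rw [h7]
  simp only [Matrix.add_mulVec, Matrix.sub_mulVec, add_dotProduct, sub_dotProduct, add_mul, sub_mul,
    ← Matrix.mulVec_mulVec, Matrix.neg_mulVec, mul_neg,
    mul_add, ht, neg_dotProduct, Matrix.mulVec_zero, dotProduct_zero, zero_dotProduct, hv]
  rw [← hp]
  ring

end MetricCurves

/-! ### Smooth dependence on the metrics -/

section Smoothness
variable {n : ℕ} {E : Type*} [NormedAddCommGroup E] [NormedSpace ℝ E]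
  {G G' : E → Matrix (Fin n) (Fin n) ℝ} {U : Set E}

theorem contDiffOn_matrix_inv (hG : ContDiffOn ℝ ∞ G U) (hd : ∀ q ∈ U, 0 < (G q).det) :
    ContDiffOn ℝ ∞ (fun q ↦ (G q)⁻¹) U :=
  fun q hq ↦ (contDiffAt_matrix_inv (hd q hq).ne').comp_contDiffWithinAt q (hG q hq)

theorem contDiffOn_adjugateMatrix (hG : ContDiffOn ℝ ∞ G U) (hG' : ContDiffOn ℝ ∞ G' U)
    (hd : ∀ q ∈ U, 0 < (G q).det) (hd' : ∀ q ∈ U, 0 < (G' q).det) (t : ℝ) :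
    ContDiffOn ℝ ∞ (fun q ↦ adjugateMatrix (G q) (G' q) t) U := by
  have h1 : ContDiffOn ℝ ∞ (fun q ↦ ((G' q).det / (G q).det) ^ (1 / ((n : ℝ) + 1))) U :=
    ((contDiff_det.comp_contDiffOn hG').div (contDiff_det.comp_contDiffOn hG)
      fun q hq ↦ (hd q hq).ne').rpow_const_of_ne fun q hq ↦ (div_pos (hd' q hq) (hd q hq)).ne'
  exact contDiff_adjugate.comp_contDiffOn
    ((h1.smul ((contDiffOn_matrix_inv hG' hd').mul hG)).sub contDiffOn_const)

theorem contDiffOn_mulVec_dotProduct {M N : E → Matrix (Fin n) (Fin n) ℝ} {u v : E → Fin n → ℝ}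
    (hM : ContDiffOn ℝ ∞ M U) (hN : ContDiffOn ℝ ∞ N U) (hu : ContDiffOn ℝ ∞ u U)
    (hv : ContDiffOn ℝ ∞ v U) : ContDiffOn ℝ ∞ (fun q ↦ (M q *ᵥ u q) ⬝ᵥ (N q *ᵥ v q)) U := by
  rw [contDiffOn_matrix_iff] at hM hN
  rw [contDiffOn_pi] at hu hv
  change ContDiffOn ℝ ∞ (fun q ↦ ∑ i, (∑ j, M q i j * u q j) * ∑ j, N q i j * v q j) U
  exact ContDiffOn.sum fun i _ ↦ (ContDiffOn.sum fun j _ ↦ (hM i j).mul (hu j)).mul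
    (ContDiffOn.sum fun j _ ↦ (hN i j).mul (hv j))

theorem contDiffOn_integralForm {u : E → Fin n → ℝ} (hG : ContDiffOn ℝ ∞ G U)
    (hG' : ContDiffOn ℝ ∞ G' U)
    (hd : ∀ q ∈ U, 0 < (G q).det) (hd' : ∀ q ∈ U, 0 < (G' q).det)
    (hu : ContDiffOn ℝ ∞ u U) (t : ℝ) :
    ContDiffOn ℝ ∞ (fun q ↦ integralForm (G q) (G' q) t (u q)) U :=
  contDiffOn_mulVec_dotProduct (contDiffOn_adjugateMatrix hG hG' hd hd' t) hG hu hu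

end Smoothness

/-! ### Change of basis -/

section ChangeOfBasis
variable {n : ℕ}

theorem benentiMatrix_congruence (G G' : Matrix (Fin n) (Fin n) ℝ) {Q : Matrix (Fin n) (Fin n) ℝ}
    (hQ : Q.det ≠ 0) :
    benentiMatrix (Qᵀ * G * Q) (Qᵀ * G' * Q) = Q⁻¹ * benentiMatrix G G' * Q := by
  have hl : Qᵀ⁻¹ * Qᵀ = 1 :=
    Matrix.nonsing_inv_mul _ (by rw [Matrix.det_transpose]; exact hQ.isUnit)
  have h1 : (Qᵀ * G' * Q).det / (Qᵀ * G * Q).det = G'.det / G.det := by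
    simp only [Matrix.det_mul, Matrix.det_transpose]
    rw [mul_div_mul_right _ _ hQ, mul_div_mul_left _ _ hQ]
  rw [benentiMatrix, h1, benentiMatrix, Matrix.mul_inv_rev, Matrix.mul_inv_rev, Matrix.mul_smul,
    Matrix.smul_mul]
  congr 1
  calc Q⁻¹ * (G'⁻¹ * Qᵀ⁻¹) * (Qᵀ * G * Q) = Q⁻¹ * (G'⁻¹ * (Qᵀ⁻¹ * Qᵀ) * (G * Q)) := by
        simp only [mul_assoc]
    _ = _ := by rw [hl, mul_one]; simp only [mul_assoc]

theorem adjugateMatrix_congruence (G G' : Matrix (Fin n) (Fin n) ℝ)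
    {Q : Matrix (Fin n) (Fin n) ℝ} (hQ : Q.det ≠ 0) (t : ℝ) :
    adjugateMatrix (Qᵀ * G * Q) (Qᵀ * G' * Q) t = Q⁻¹ * adjugateMatrix G G' t * Q := by
  have hl : Q⁻¹ * Q = 1 := Matrix.nonsing_inv_mul _ hQ.isUnit
  have h1 : Q⁻¹ * benentiMatrix G G' * Q - t • (1 : Matrix (Fin n) (Fin n) ℝ)
      = Q⁻¹ * (benentiMatrix G G' - t • 1) * Q := by
    rw [mul_sub, sub_mul, Matrix.mul_smul, Matrix.smul_mul, mul_one, hl]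
  have hQ' : Q⁻¹.det ≠ 0 := by
    intro h
    have h2 := congrArg Matrix.det hl
    rw [Matrix.det_mul, h, zero_mul, Matrix.det_one] at h2
    exact zero_ne_one h2
  have h2 : Q.det * Q⁻¹.det = 1 := by
    rw [mul_comm, ← Matrix.det_mul, hl, Matrix.det_one]
  rw [adjugateMatrix, benentiMatrix_congruence G G' hQ, h1, Matrix.adjugate_mul_distrib,
    Matrix.adjugate_mul_distrib, adjugate_eq_det_smul_inv hQ, adjugate_eq_det_smul_inv hQ',
    Matrix.nonsing_inv_nonsing_inv _ hQ.isUnit, Matrix.smul_mul, Matrix.mul_smul, Matrix.mul_smul,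
    smul_smul, h2, one_smul, ← mul_assoc, adjugateMatrix]

theorem integralForm_congruence (G G' : Matrix (Fin n) (Fin n) ℝ)
    {Q : Matrix (Fin n) (Fin n) ℝ} (hQ : Q.det ≠ 0) (t : ℝ) (u : Fin n → ℝ) :
    integralForm (Qᵀ * G * Q) (Qᵀ * G' * Q) t u = integralForm G G' t (Q *ᵥ u) := by
  have hr : Q * Q⁻¹ = 1 := Matrix.mul_nonsing_inv _ hQ.isUnit
  rw [integralForm, adjugateMatrix_congruence G G' hQ, integralForm, mul_assoc Qᵀ,
    ← Matrix.mulVec_mulVec _ Qᵀ, Matrix.dotProduct_mulVec, Matrix.vecMul_transpose,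
    Matrix.mulVec_mulVec, mul_assoc Q⁻¹, ← mul_assoc Q, hr, one_mul, ← Matrix.mulVec_mulVec,
    ← Matrix.mulVec_mulVec]

end ChangeOfBasis

/-! ### Symmetric bilinear maps with parallel values -/

section Projective
variable {V : Type*} [AddCommGroup V] [Module ℝ V]

/-- A symmetric bilinear map whose value on each pair `(u, u)` is proportional to `u` has the form
`(u, v) ↦ φ(u) v + φ(v) u` for a linear form `φ`. -/
theorem exists_linear_of_parallel (D : V →ₗ[ℝ] V →ₗ[ℝ] V) (hD : ∀ u v, D u v = D v u)
    (hpar : ∀ u, ∃ c : ℝ, D u u = c • u) :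
    ∃ φ : V →ₗ[ℝ] ℝ, ∀ u v, D u v = φ u • v + φ v • u := by
  choose c hc using hpar
  classical
  -- The factor is not determined at `u = 0`, so it is normalized there. Since `D(u, u) = 2 φ(u) u`,
  -- the linear form is half the factor.
  set f : V → ℝ := fun u ↦ if u = 0 then 0 else c u / 2 with hf
  have hf0 : f 0 = 0 := by simp [hf]
  have hfD : ∀ u, D u u = (2 * f u) • u := by
    intro u
    by_cases hu : u = 0
    · simp [hu]
    · rw [hc u, hf]
      simp only [hu, if_false]
      congr 1
      ring
  have hsmul : ∀ (a : ℝ) u, f (a • u) = a * f u := by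
    intro a u
    by_cases ha : a = 0
    · simp [ha, hf0]
    by_cases hu : u = 0
    · simp [hu, hf0]
    have h1 := hfD (a • u)
    rw [map_smul, map_smul, LinearMap.smul_apply, hfD u, smul_smul, smul_smul, smul_smul] at h1
    have h2 := smul_left_injective ℝ hu h1
    have h3 : (2 * a) * (f (a • u)) = (2 * a) * (a * f u) := by linarith
    exact mul_left_cancel₀ (by simpa using ha) h3
  have hadd : ∀ u v, f (u + v) = f u + f v := by
    intro u v
    by_cases hu : u = 0
    · simp [hu, hf0]
    by_cases hv : ∃ a : ℝ, a • u = v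
    · obtain ⟨a, rfl⟩ := hv
      have h1 : u + a • u = (1 + a) • u := by rw [add_smul, one_smul]
      rw [h1, hsmul, hsmul]
      ring
    · push Not at hv
      have hli := LinearIndependent.pair_iff.1 ((LinearIndependent.pair_iff' hu).2 hv)
      have h1 : (2 * f (u + v) + 2 * f (u - v) - 4 * f u) • u
          + (2 * f (u + v) - 2 * f (u - v) - 4 * f v) • v = 0 := by
        -- The parallelogram identity, whose coefficients on the independent vectors `u` and `v`
        -- give the additivity of `f` on adding them.
        have e : D (u + v) (u + v) + D (u - v) (u - v) = (2 : ℝ) • D u u + (2 : ℝ) • D v v := by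
          simp only [map_add, map_sub, LinearMap.add_apply, LinearMap.sub_apply]
          module
        rw [hfD, hfD, hfD, hfD] at e
        rw [← sub_eq_zero] at e
        rw [← e]
        module
      obtain ⟨h2, h3⟩ := hli _ _ h1
      linarith
  refine ⟨⟨⟨f, hadd⟩, hsmul⟩, fun u v ↦ ?_⟩
  -- Polarization.
  have h1 := hfD (u + v)
  simp only [map_add, LinearMap.add_apply, hfD u, hfD v, hadd, hD v u] at h1
  have h2 : (2 : ℝ) • D u v = (2 : ℝ) • (f u • v + f v • u) := by
    have h3 : (2 : ℝ) • D u v = ((2 * f u) • u + D u v + (D u v + (2 * f v) • v))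
        - (2 * f u) • u - (2 * f v) • v := by module
    rw [h3, h1]
    module
  exact smul_right_injective V (two_ne_zero' ℝ) h2

end Projective

/-! ### Metrics and integrals in a chart -/

section Coordinates
variable {n : ℕ} {M : Type*} [TopologicalSpace M] [ChartedSpace (Model n) M]

theorem coord_coordInv {x₀ : M} {q : Model n} (hq : q ∈ (extChartAt (𝓡 n) x₀).target) :
    coord x₀ (coordInv x₀ q) = q :=
  (extChartAt (𝓡 n) x₀).right_inv hq

theorem coordInv_mem_source {x₀ : M} {q : Model n} (hq : q ∈ (extChartAt (𝓡 n) x₀).target) :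
    coordInv x₀ q ∈ (chartAt (Model n) x₀).source := by
  rw [← extChartAt_source (𝓡 n)]
  exact (extChartAt (𝓡 n) x₀).map_target hq

theorem exists_coordInv_eq {x₀ x : M} (hx : x ∈ (chartAt (Model n) x₀).source) :
    ∃ q ∈ (extChartAt (𝓡 n) x₀).target, coordInv x₀ q = x := by
  rw [← extChartAt_source (𝓡 n)] at hx
  exact ⟨_, (extChartAt (𝓡 n) x₀).map_source hx, (extChartAt (𝓡 n) x₀).left_inv hx⟩

theorem coord_mem_target {x₀ x : M} (hx : x ∈ (chartAt (Model n) x₀).source) :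
    coord x₀ x ∈ (extChartAt (𝓡 n) x₀).target := by
  rw [← extChartAt_source (𝓡 n)] at hx
  exact (extChartAt (𝓡 n) x₀).map_source hx

theorem tangentBasis_apply (x : M) (i : Fin n) :
    tangentBasis x i = (EuclideanSpace.single i (1 : ℝ) : Model n) :=
  (congrFun (EuclideanSpace.basisFun (Fin n) ℝ).coe_toBasis i).trans
    (EuclideanSpace.basisFun_apply _ _ _)

variable [IsManifold (𝓡 n) ∞ M]

theorem dCoord_dCoordInv {x₀ : M} {q : Model n} (hq : q ∈ (extChartAt (𝓡 n) x₀).target)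
    (u : Model n) : dCoord x₀ (coordInv x₀ q) (dCoordInv x₀ q u) = u := by
  have h := mfderiv_extChartAt_comp_mfderivWithin_extChartAt_symm (I := 𝓡 n) hq
  rw [ModelWithCorners.Boundaryless.range_eq_univ, mfderivWithin_univ] at h
  exact DFunLike.congr_fun h u

theorem dCoordInv_dCoord {x₀ : M} {q : Model n} (hq : q ∈ (extChartAt (𝓡 n) x₀).target)
    (v : TangentSpace (𝓡 n) (coordInv x₀ q)) :
    dCoordInv x₀ q (dCoord x₀ (coordInv x₀ q) v) = v := by
  have h := mfderivWithin_extChartAt_symm_comp_mfderiv_extChartAt (I := 𝓡 n) hq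
  rw [ModelWithCorners.Boundaryless.range_eq_univ, mfderivWithin_univ] at h
  exact DFunLike.congr_fun h v

/-- The metric at a point of the chart domain, in terms of its coefficients. -/
theorem inner_eq_metricCoeff (g : Metric n M) {x₀ x : M}
    (hx : x ∈ (chartAt (Model n) x₀).source) (v w : TangentSpace (𝓡 n) x) :
    g.inner x v w = metricCoeff g x₀ (coord x₀ x) (dCoord x₀ x v) (dCoord x₀ x w) := by
  obtain ⟨q, hq, rfl⟩ := exists_coordInv_eq hx
  rw [coord_coordInv hq, metricCoeff, dCoordInv_dCoord hq, dCoordInv_dCoord hq]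

/-- The coordinate vector fields of a chart are smooth. -/
theorem contMDiffOn_dCoordInv (x₀ : M) (u : Model n) :
    ContMDiffOn 𝓘(ℝ, Model n) ((𝓡 n).prod 𝓘(ℝ, Model n)) ∞
      (fun q : Model n ↦ Bundle.TotalSpace.mk' (Model n)
        (E := fun x : M ↦ TangentSpace (𝓡 n) x) (coordInv x₀ q) (dCoordInv x₀ q u))
      (extChartAt (𝓡 n) x₀).target := by
  have hb : ∀ q ∈ (extChartAt (𝓡 n) x₀).target, coordInv x₀ q ∈
      (trivializationAt (Model n) (fun x : M ↦ TangentSpace (𝓡 n) x) x₀).baseSet := fun q hq ↦ by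
    rw [TangentBundle.trivializationAt_baseSet]
    exact coordInv_mem_source hq
  rw [(trivializationAt (Model n) (fun x : M ↦ TangentSpace (𝓡 n) x) x₀).contMDiffOn_iff
    fun q hq ↦ (Bundle.Trivialization.mem_source _).2 (hb q hq)]
  refine ⟨contMDiffOn_extChartAt_symm x₀, (contMDiffOn_const (c := u)).congr fun q hq ↦ ?_⟩
  have h1 := TangentBundle.continuousLinearMapAt_trivializationAt (I := 𝓡 n)
    (coordInv_mem_source hq)
  have h2 := DFunLike.congr_fun h1 (dCoordInv x₀ q u)
  rw [Bundle.Trivialization.continuousLinearMapAt_apply, Bundle.Trivialization.linearMapAt_apply,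
    if_pos (hb q hq)] at h2
  exact h2.trans (dCoord_dCoordInv hq u)

theorem contDiffOn_metricCoeff (g : Metric n M) (x₀ : M) (u v : Model n) :
    ContDiffOn ℝ ∞ (fun q ↦ metricCoeff g x₀ q u v) (extChartAt (𝓡 n) x₀).target := by
  have hg := g.contMDiff.comp_contMDiffOn (contMDiffOn_extChartAt_symm (n := ∞) (I := 𝓡 n) x₀)
  have h := ContMDiffOn.clm_bundle_apply₂ (F₁ := Model n) (F₂ := Model n) (F₃ := ℝ)
    (E₁ := fun x : M ↦ TangentSpace (𝓡 n) x) (E₂ := fun x : M ↦ TangentSpace (𝓡 n) x)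
    (E₃ := fun _ : M ↦ ℝ) (b := fun q ↦ coordInv x₀ q)
    (ψ := fun q ↦ g.inner (coordInv x₀ q))
    hg (contMDiffOn_dCoordInv x₀ u) (contMDiffOn_dCoordInv x₀ v)
  rw [← contMDiffOn_iff_contDiffOn]
  intro q hq
  have := h q hq
  simp only [Bundle.contMDiffWithinAt_totalSpace] at this
  exact this.2

theorem metricCoeff_symm (g : Metric n M) (x₀ : M) (q u v : Model n) :
    metricCoeff g x₀ q u v = metricCoeff g x₀ q v u :=
  g.symm _ _ _

/-- The matrix of the metric in the chart around `x₀`, at the point with coordinates `q`. -/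
noncomputable def gramIn (g : Metric n M) (x₀ : M) (q : Model n) : Matrix (Fin n) (Fin n) ℝ :=
  Matrix.of fun i j ↦ metricCoeff g x₀ q (EuclideanSpace.single i 1) (EuclideanSpace.single j 1)

theorem sum_smul_single (u : Model n) : ∑ i, u i • EuclideanSpace.single i (1 : ℝ) = u := by
  have h := (EuclideanSpace.basisFun (Fin n) ℝ).sum_repr u
  simpa using h

theorem bilin_eq_dotProduct (B : Model n →L[ℝ] Model n →L[ℝ] ℝ) (u v : Model n) :
    B u v = u.ofLp ⬝ᵥ ((Matrix.of fun i j ↦ B (EuclideanSpace.single i 1)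
      (EuclideanSpace.single j 1)) *ᵥ v.ofLp) := by
  conv_lhs => rw [← sum_smul_single u, ← sum_smul_single v]
  simp only [map_sum, map_smul, FunLike.coe_sum, Finset.sum_apply, _root_.smul_apply,
    smul_eq_mul, dotProduct, mulVec, Matrix.of_apply, Finset.mul_sum]
  rw [Finset.sum_comm]
  refine Finset.sum_congr rfl fun i _ ↦ Finset.sum_congr rfl fun j _ ↦ by ring

/-- The pullback of a bilinear form by a linear map. -/
noncomputable def pullbackForm (B : Model n →L[ℝ] Model n →L[ℝ] ℝ) (A : Model n →L[ℝ] Model n) :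
    Model n →L[ℝ] Model n →L[ℝ] ℝ :=
  B.bilinearComp A A

/-- The coefficients of the metric as a bilinear form on `ℝⁿ`. -/
noncomputable def metricForm (g : Metric n M) (x₀ : M) (q : Model n) :
    Model n →L[ℝ] Model n →L[ℝ] ℝ :=
  pullbackForm (g.inner (coordInv x₀ q)) (dCoordInv x₀ q)

theorem metricForm_apply (g : Metric n M) (x₀ : M) (q u v : Model n) :
    metricForm g x₀ q u v = metricCoeff g x₀ q u v := rfl

theorem metricCoeff_eq_dotProduct (g : Metric n M) (x₀ : M) (q u v : Model n) :
    metricCoeff g x₀ q u v = u.ofLp ⬝ᵥ (gramIn g x₀ q *ᵥ v.ofLp) :=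
  bilin_eq_dotProduct (metricForm g x₀ q) u v

theorem metricCoeff_pos (g : Metric n M) {x₀ : M} {q : Model n}
    (hq : q ∈ (extChartAt (𝓡 n) x₀).target) {u : Model n} (hu : u ≠ 0) :
    0 < metricCoeff g x₀ q u u := by
  refine g.pos _ _ fun h ↦ hu ?_
  rw [← dCoord_dCoordInv hq u, h, map_zero]

theorem transpose_gramIn (g : Metric n M) (x₀ : M) (q : Model n) :
    (gramIn g x₀ q)ᵀ = gramIn g x₀ q := by
  ext i j
  exact metricCoeff_symm g x₀ q _ _

theorem det_gramIn_pos (g : Metric n M) {x₀ : M} {q : Model n}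
    (hq : q ∈ (extChartAt (𝓡 n) x₀).target) : 0 < (gramIn g x₀ q).det := by
  refine (Matrix.PosDef.of_dotProduct_mulVec_pos (transpose_gramIn g x₀ q) fun u hu ↦ ?_).det_pos
  have h := metricCoeff_pos g hq (u := WithLp.toLp 2 u)
    (fun h ↦ hu (by simpa using congrArg WithLp.ofLp h))
  rw [metricCoeff_eq_dotProduct] at h
  rwa [star_trivial]

theorem contDiffOn_gramIn (g : Metric n M) (x₀ : M) :
    ContDiffOn ℝ ∞ (gramIn g x₀) (extChartAt (𝓡 n) x₀).target :=
  contDiffOn_matrix_iff.2 fun _ _ ↦ contDiffOn_metricCoeff g x₀ _ _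

theorem gram_apply (g : Metric n M) (x : M) (i j : Fin n) :
    gram g x i j = g.inner x (tangentBasis x i) (tangentBasis x j) := rfl

theorem inner_eq_dotProduct (g : Metric n M) (x : M) (v w : Model n) :
    g.inner x v w = v.ofLp ⬝ᵥ (gram g x *ᵥ w.ofLp) := by
  have h := bilin_eq_dotProduct (g.inner x) v w
  have h2 : gram g x = Matrix.of fun i j ↦ g.inner x (EuclideanSpace.single i (1 : ℝ) : Model n)
      (EuclideanSpace.single j (1 : ℝ) : Model n) := by
    ext i j
    simp only [gram, Matrix.of_apply, tangentBasis_apply]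
  rw [h2]
  exact h

/-- The matrix of the tensor `L` in the preferred basis. -/
theorem toMatrix_tensorL (g g' : Metric n M) (x : M) (hd : (gram g' x).det ≠ 0) :
    LinearMap.toMatrix (tangentBasis x) (tangentBasis x) (tensorL g g' x)
      = benentiMatrix (gram g x) (gram g' x) := by
  have hl : (gram g' x)⁻¹ * gram g' x = 1 := Matrix.nonsing_inv_mul _ hd.isUnit
  rw [tensorL, map_smul, benentiMatrix]
  congr 1
  set T : TangentSpace (𝓡 n) x →L[ℝ] TangentSpace (𝓡 n) x :=
    (g'.inner x).inverse ∘L g.inner x with hT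
  have hgT : ∀ v w, g'.inner x (T v) w = g.inner x v w := fun v w ↦ by
    have h := (isInvertible_inner g' x).inverse_apply_eq (x := T v) (y := g.inner x v)
    rw [← h.1 rfl]
  have h1 : gram g' x * LinearMap.toMatrix (tangentBasis x) (tangentBasis x) T = gram g x := by
    ext i j
    rw [Matrix.mul_apply, gram_apply, g.symm, ← hgT, g'.symm]
    conv_rhs => rw [← (tangentBasis x).sum_repr (T (tangentBasis x j))]
    simp only [map_sum, map_smul, smul_eq_mul]
    refine Finset.sum_congr rfl fun k _ ↦ ?_
    rw [LinearMap.toMatrix_apply, mul_comm]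
    rfl
  rw [← h1, ← mul_assoc, hl, one_mul]

/-- The integral `I_t` in the preferred chart around the base point, where `S_t` is defined. -/
theorem integral_eq_integralForm_gram (g g' : Metric n M) (t : ℝ) (x : M) (v : Model n)
    (hd : (gram g' x).det ≠ 0) :
    integral g g' t (⟨x, v⟩ : TangentBundle (𝓡 n) M)
      = integralForm (gram g x) (gram g' x) t v.ofLp := by
  have h1 := LinearMap.toMatrix_mulVec_repr (tangentBasis x) (tangentBasis x)
    (tensorS g g' t x) v
  have h2 : LinearMap.toMatrix (tangentBasis x) (tangentBasis x) (tensorS g g' t x)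
      = adjugateMatrix (gram g x) (gram g' x) t := by
    rw [tensorS, LinearMap.toMatrix_toLin, map_sub, toMatrix_tensorL g g' x hd, map_smul,
      LinearMap.toMatrix_id, adjugateMatrix]
  rw [h2] at h1
  refine (inner_eq_dotProduct g x (tensorS g g' t x v) v).trans ?_
  exact congrArg (· ⬝ᵥ (gram g x *ᵥ v.ofLp)) h1.symm

theorem toMatrix_mulVec_ofLp (T : Model n →L[ℝ] Model n) (v : Model n) :
    (Matrix.of fun i j ↦ T (EuclideanSpace.single j 1) i) *ᵥ v.ofLp = (T v).ofLp := by
  ext i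
  conv_rhs => rw [← sum_smul_single v]
  simp [mulVec, dotProduct, mul_comm]

/-- The integral `I_t` in the chart around `x₀`. -/
theorem integral_eq_integralForm (g g' : Metric n M) (t : ℝ) {x₀ x : M}
    (hx : x ∈ (chartAt (Model n) x₀).source) (v : Model n) :
    integral g g' t (⟨x, v⟩ : TangentBundle (𝓡 n) M)
      = integralForm (gramIn g x₀ (coord x₀ x)) (gramIn g' x₀ (coord x₀ x)) t
          (dCoord x₀ x v).ofLp := by
  -- The matrix of the differential of the chart around `x₀`, in the preferred basis at `x`.
  set Q : Matrix (Fin n) (Fin n) ℝ :=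
    Matrix.of fun i j ↦ (dCoord x₀ x (EuclideanSpace.single j (1 : ℝ) : Model n)) i with hQ
  have hQv : ∀ w : Model n, Q *ᵥ w.ofLp = (dCoord x₀ x w).ofLp :=
    fun w ↦ toMatrix_mulVec_ofLp (dCoord x₀ x) w
  have hgram : ∀ h : Metric n M, gram h x = Qᵀ * gramIn h x₀ (coord x₀ x) * Q := by
    intro h
    ext i j
    rw [gram, Matrix.of_apply, inner_eq_metricCoeff h hx, metricCoeff_eq_dotProduct,
      tangentBasis_apply, tangentBasis_apply, ← hQv, ← hQv]
    simp [Matrix.mul_apply, dotProduct, mulVec, Finset.mul_sum, Finset.sum_mul, mul_assoc]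
    rw [Finset.sum_comm]
  have hQd : Q.det ≠ 0 := by
    intro h
    obtain ⟨w, hw, h0⟩ := Matrix.exists_mulVec_eq_zero_iff.2 h
    have hinj := (isInvertible_mfderiv_extChartAt (I := 𝓡 n)
      (y := x) (x := x₀) (by rwa [extChartAt_source])).injective
    have h1 : dCoord x₀ x (WithLp.toLp 2 w : Model n) = 0 := by
      have h2 := hQv (WithLp.toLp 2 w)
      rw [h0] at h2
      exact (WithLp.ofLp_injective 2 h2).symm
    have h3 : (WithLp.toLp 2 w : Model n) = 0 := hinj (h1.trans (map_zero (dCoord x₀ x)).symm)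
    exact hw (congrArg WithLp.ofLp h3)
  have hd : (gram g' x).det ≠ 0 := by
    rw [hgram, Matrix.det_mul, Matrix.det_mul, Matrix.det_transpose]
    exact mul_ne_zero (mul_ne_zero hQd (det_gramIn_pos g' (coord_mem_target hx)).ne') hQd
  rw [integral_eq_integralForm_gram g g' t x v hd, hgram, hgram, integralForm_congruence _ _ hQd,
    hQv]

end Coordinates

/-! ### The Levi-Civita connection in a chart -/

section Connection
variable {n : ℕ} {M : Type*} [TopologicalSpace M] [ChartedSpace (Model n) M]
  [IsManifold (𝓡 n) ∞ M]

theorem contDiffOn_metricForm (g : Metric n M) (x₀ : M) :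
    ContDiffOn ℝ ∞ (metricForm g x₀) (extChartAt (𝓡 n) x₀).target := by
  rw [contDiffOn_clm_apply]
  intro u
  rw [contDiffOn_clm_apply]
  intro v
  exact contDiffOn_metricCoeff g x₀ u v

theorem differentiableAt_metricForm (g : Metric n M) {x₀ : M} {q : Model n}
    (hq : q ∈ (extChartAt (𝓡 n) x₀).target) : DifferentiableAt ℝ (metricForm g x₀) q :=
  ((contDiffOn_metricForm g x₀).contDiffAt
    ((isOpen_extChartAt_target x₀).mem_nhds hq)).differentiableAt (by simp)

theorem fderiv_metricCoeff (g : Metric n M) {x₀ : M} {q : Model n}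
    (hq : q ∈ (extChartAt (𝓡 n) x₀).target) (u v w : Model n) :
    fderiv ℝ (fun q' ↦ metricCoeff g x₀ q' v w) q u = fderiv ℝ (metricForm g x₀) q u v w := by
  have h : HasFDerivAt (fun q' ↦ metricCoeff g x₀ q' v w) _ q :=
    (((differentiableAt_metricForm g hq).hasFDerivAt.clm_apply (hasFDerivAt_const v q)).clm_apply
      (hasFDerivAt_const w q))
  rw [h.fderiv]
  simp

/-- The Christoffel symbols of the first kind, `(v, w) ↦ Γ(u, v, w)`, as a bilinear form. -/
noncomputable def christoffelForm (g : Metric n M) (x₀ : M) (q u : Model n) :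
    Model n →L[ℝ] Model n →L[ℝ] ℝ :=
  (1 / 2 : ℝ) • (fderiv ℝ (metricForm g x₀) q u + (fderiv ℝ (metricForm g x₀) q).flip u
    - ((fderiv ℝ (metricForm g x₀) q).flip u).flip)

theorem christoffelForm_apply (g : Metric n M) {x₀ : M} {q : Model n}
    (hq : q ∈ (extChartAt (𝓡 n) x₀).target) (u v w : Model n) :
    christoffelForm g x₀ q u v w = christoffel g x₀ q u v w := by
  rw [christoffel, fderiv_metricCoeff g hq, fderiv_metricCoeff g hq, fderiv_metricCoeff g hq,
    christoffelForm]
  simp only [_root_.smul_apply, _root_.add_apply, _root_.sub_apply, ContinuousLinearMap.flip_apply,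
    smul_eq_mul]
  ring

theorem fderiv_metricForm_symm (g : Metric n M) {x₀ : M} {q : Model n}
    (hq : q ∈ (extChartAt (𝓡 n) x₀).target) (u v w : Model n) :
    fderiv ℝ (metricForm g x₀) q u v w = fderiv ℝ (metricForm g x₀) q u w v := by
  rw [← fderiv_metricCoeff g hq, ← fderiv_metricCoeff g hq]
  simp only [metricCoeff_symm g x₀ _ v w]

theorem christoffelForm_symm (g : Metric n M) {x₀ : M} {q : Model n}
    (hq : q ∈ (extChartAt (𝓡 n) x₀).target) (u v w : Model n) :
    christoffelForm g x₀ q u v w = christoffelForm g x₀ q v u w := by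
  simp only [christoffelForm, _root_.smul_apply, _root_.add_apply, _root_.sub_apply,
    ContinuousLinearMap.flip_apply, smul_eq_mul, fderiv_metricForm_symm g hq w u v]
  ring

/-- The connection is metric. -/
theorem christoffelForm_add_swap (g : Metric n M) {x₀ : M} {q : Model n}
    (hq : q ∈ (extChartAt (𝓡 n) x₀).target) (u v w : Model n) :
    christoffelForm g x₀ q u v w + christoffelForm g x₀ q u w v
      = fderiv ℝ (metricForm g x₀) q u v w := by
  simp only [christoffelForm, _root_.smul_apply, _root_.add_apply, _root_.sub_apply,
    ContinuousLinearMap.flip_apply, smul_eq_mul, fderiv_metricForm_symm g hq u w v]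
  ring

/-- The matrix of the connection in the direction `u`: it sends `v` to `Γ(u, v)`, where `Γ` are the
Christoffel symbols of the second kind. -/
noncomputable def connectionMatrix (g : Metric n M) (x₀ : M) (q u : Model n) :
    Matrix (Fin n) (Fin n) ℝ :=
  (gramIn g x₀ q)⁻¹ * Matrix.of fun i j ↦ christoffelForm g x₀ q u (EuclideanSpace.single j 1)
    (EuclideanSpace.single i 1)

theorem gramIn_mul_connectionMatrix (g : Metric n M) {x₀ : M} {q : Model n}
    (hq : q ∈ (extChartAt (𝓡 n) x₀).target) (u : Model n) :
    gramIn g x₀ q * connectionMatrix g x₀ q u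
      = Matrix.of fun i j ↦ christoffelForm g x₀ q u (EuclideanSpace.single j 1)
        (EuclideanSpace.single i 1) := by
  rw [connectionMatrix, ← mul_assoc,
    Matrix.mul_nonsing_inv _ (det_gramIn_pos g hq).ne'.isUnit, one_mul]

/-- The symbols of the second kind are obtained from those of the first kind by raising an index. -/
theorem dotProduct_connectionMatrix (g : Metric n M) {x₀ : M} {q : Model n}
    (hq : q ∈ (extChartAt (𝓡 n) x₀).target) (u v w : Model n) :
    w.ofLp ⬝ᵥ (gramIn g x₀ q *ᵥ (connectionMatrix g x₀ q u *ᵥ v.ofLp))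
      = christoffel g x₀ q u v w := by
  rw [Matrix.mulVec_mulVec, gramIn_mul_connectionMatrix g hq, ← christoffelForm_apply g hq]
  exact (bilin_eq_dotProduct (christoffelForm g x₀ q u).flip w v).symm

theorem eq_of_forall_dotProduct_gramIn (g : Metric n M) {x₀ : M} {q : Model n}
    (hq : q ∈ (extChartAt (𝓡 n) x₀).target) {y z : Fin n → ℝ}
    (h : ∀ w : Model n, w.ofLp ⬝ᵥ (gramIn g x₀ q *ᵥ y) = w.ofLp ⬝ᵥ (gramIn g x₀ q *ᵥ z)) :
    y = z := by
  have h1 : gramIn g x₀ q *ᵥ y = gramIn g x₀ q *ᵥ z :=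
    dotProduct_eq _ _ fun w ↦ by
      rw [dotProduct_comm, dotProduct_comm _ w]
      exact h (WithLp.toLp 2 w)
  have h2 := congrArg ((gramIn g x₀ q)⁻¹ *ᵥ ·) h1
  simpa [Matrix.mulVec_mulVec, Matrix.nonsing_inv_mul _ (det_gramIn_pos g hq).ne'.isUnit] using h2

theorem connectionMatrix_symm (g : Metric n M) {x₀ : M} {q : Model n}
    (hq : q ∈ (extChartAt (𝓡 n) x₀).target) (u v : Model n) :
    connectionMatrix g x₀ q u *ᵥ v.ofLp = connectionMatrix g x₀ q v *ᵥ u.ofLp := by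
  refine eq_of_forall_dotProduct_gramIn g hq fun w ↦ ?_
  rw [dotProduct_connectionMatrix g hq, dotProduct_connectionMatrix g hq,
    ← christoffelForm_apply g hq, ← christoffelForm_apply g hq, christoffelForm_symm g hq]

/-- The compatibility of the connection with the metric, along a curve. -/
theorem hasDerivAt_gramIn (g : Metric n M) {x₀ : M} {c : ℝ → Model n} {s : ℝ} {u : Model n}
    (hq : c s ∈ (extChartAt (𝓡 n) x₀).target) (hc : HasDerivAt c u s) :
    HasDerivAt (fun r ↦ gramIn g x₀ (c r))
      ((connectionMatrix g x₀ (c s) u)ᵀ * gramIn g x₀ (c s)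
        + gramIn g x₀ (c s) * connectionMatrix g x₀ (c s) u) s := by
  have h1 : (connectionMatrix g x₀ (c s) u)ᵀ * gramIn g x₀ (c s)
      = (gramIn g x₀ (c s) * connectionMatrix g x₀ (c s) u)ᵀ := by
    rw [Matrix.transpose_mul, transpose_gramIn]
  rw [h1, gramIn_mul_connectionMatrix g hq, hasDerivAt_matrix_iff]
  intro i j
  have h2 : DifferentiableAt ℝ (fun q ↦ metricCoeff g x₀ q (EuclideanSpace.single i 1)
      (EuclideanSpace.single j 1)) (c s) :=
    ((contDiffOn_metricCoeff g x₀ _ _).contDiffAt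
      ((isOpen_extChartAt_target x₀).mem_nhds hq)).differentiableAt (by simp)
  refine (h2.hasFDerivAt.comp_hasDerivAt s hc).congr_deriv ?_
  rw [fderiv_metricCoeff g hq, ← christoffelForm_add_swap g hq]
  rfl

end Connection

/-! ### Change of chart -/

section Transition
variable {n : ℕ} {M : Type*} [TopologicalSpace M] [ChartedSpace (Model n) M]
  [IsManifold (𝓡 n) ∞ M]

/-- The transition map from the coordinates around `x₀` to those around `x₁`. -/
noncomputable def transition (x₀ x₁ : M) (q : Model n) : Model n := coord x₁ (coordInv x₀ q)

theorem contDiffAt_transition {x₀ x₁ : M} {q : Model n}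
    (hq : q ∈ (extChartAt (𝓡 n) x₀).target)
    (h₁ : coordInv x₀ q ∈ (chartAt (Model n) x₁).source) :
    ContDiffAt ℝ ∞ (transition (n := n) x₀ x₁) q := by
  rw [← contMDiffAt_iff_contDiffAt]
  exact (contMDiffAt_extChartAt' h₁).comp q ((contMDiffOn_extChartAt_symm x₀).contMDiffAt
    ((isOpen_extChartAt_target x₀).mem_nhds hq))

theorem fderiv_transition {x₀ x₁ : M} {q : Model n}
    (hq : q ∈ (extChartAt (𝓡 n) x₀).target)
    (h₁ : coordInv x₀ q ∈ (chartAt (Model n) x₁).source) (u : Model n) :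
    fderiv ℝ (transition (n := n) x₀ x₁) q u
      = dCoord x₁ (coordInv x₀ q) (dCoordInv x₀ q u) := by
  have h := mfderiv_comp (I := 𝓘(ℝ, Model n)) (I' := 𝓡 n) (I'' := 𝓘(ℝ, Model n)) q
    (f := coordInv (n := n) x₀) (g := coord (n := n) x₁)
    (mdifferentiableAt_extChartAt h₁)
    (((contMDiffOn_extChartAt_symm (n := ∞) x₀).contMDiffAt
    ((isOpen_extChartAt_target x₀).mem_nhds hq)).mdifferentiableAt (by simp))
  rw [mfderiv_eq_fderiv] at h
  exact DFunLike.congr_fun h u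

theorem metricForm_transition (g : Metric n M) {x₀ x₁ : M} {q : Model n}
    (hq : q ∈ (extChartAt (𝓡 n) x₀).target)
    (h₁ : coordInv x₀ q ∈ (chartAt (Model n) x₁).source) (u v : Model n) :
    metricForm g x₀ q u v = metricForm g x₁ (transition x₀ x₁ q)
      (fderiv ℝ (transition (n := n) x₀ x₁) q u) (fderiv ℝ (transition (n := n) x₀ x₁) q v) := by
  rw [fderiv_transition hq h₁, fderiv_transition hq h₁, metricForm_apply, metricForm_apply]
  exact inner_eq_metricCoeff g h₁ _ _

end Transition

/-! ### Second derivatives of composites -/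

section SecondDerivatives
variable {E F : Type*} [NormedAddCommGroup E] [NormedSpace ℝ E] [NormedAddCommGroup F]
  [NormedSpace ℝ F]

theorem two_le_infty : (2 : ℕ∞ω) ≤ ∞ := ENat.LEInfty.out

theorem hasFDerivAt_fderiv_of_contDiffAt {ψ : E → F} {q : E} (hψ : ContDiffAt ℝ 2 ψ q) :
    HasFDerivAt (fderiv ℝ ψ) (fderiv ℝ (fderiv ℝ ψ) q) q :=
  ((hψ.fderiv_right (m := 1) (by norm_num)).differentiableAt (by simp)).hasFDerivAt

/-- The derivative of the pullback of a field of bilinear forms by a map. -/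
theorem fderiv_pullback {B : E → E →L[ℝ] E →L[ℝ] ℝ} {ψ : E → E} {q : E}
    (hψ : ContDiffAt ℝ 2 ψ q) (hB : DifferentiableAt ℝ B (ψ q)) (u v w : E) :
    fderiv ℝ (fun q' ↦ B (ψ q') (fderiv ℝ ψ q' v) (fderiv ℝ ψ q' w)) q u
      = fderiv ℝ B (ψ q) (fderiv ℝ ψ q u) (fderiv ℝ ψ q v) (fderiv ℝ ψ q w)
        + B (ψ q) (fderiv ℝ (fderiv ℝ ψ) q u v) (fderiv ℝ ψ q w)
        + B (ψ q) (fderiv ℝ ψ q v) (fderiv ℝ (fderiv ℝ ψ) q u w) := by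
  have hψ1 := (hψ.differentiableAt (by simp)).hasFDerivAt
  have hψ2 := hasFDerivAt_fderiv_of_contDiffAt hψ
  have hB' : HasFDerivAt (fun q' ↦ B (ψ q')) _ q :=
    HasFDerivAt.comp (G := E →L[ℝ] E →L[ℝ] ℝ) (g := B) q hB.hasFDerivAt hψ1
  have hv : HasFDerivAt (fun q' ↦ B (ψ q') (fderiv ℝ ψ q' v)) _ q :=
    hB'.clm_apply (hψ2.clm_apply (hasFDerivAt_const v q))
  have hw : HasFDerivAt (fun q' ↦ B (ψ q') (fderiv ℝ ψ q' v) (fderiv ℝ ψ q' w)) _ q :=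
    hv.clm_apply (hψ2.clm_apply (hasFDerivAt_const w q))
  rw [hw.fderiv]
  simp
  ring

theorem contDiffOn_fderiv_apply₃ {B : E → E →L[ℝ] E →L[ℝ] ℝ} {U : Set E} (hU : IsOpen U)
    (hB : ContDiffOn ℝ ∞ B U) {a b d : E × E → E} (ha : ContDiff ℝ ∞ a) (hb : ContDiff ℝ ∞ b)
    (hd : ContDiff ℝ ∞ d) :
    ContDiffOn ℝ ∞ (fun z : E × E ↦ fderiv ℝ B z.1 (a z) (b z) (d z)) (U ×ˢ Set.univ) :=
  ((((hB.fderiv_of_isOpen hU (m := ∞) (by simp)).comp contDiffOn_fst fun _ hz ↦ hz.1).clm_apply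
    ha.contDiffOn).clm_apply hb.contDiffOn).clm_apply hd.contDiffOn

theorem hasDerivAt_deriv_of_contDiffAt {c : ℝ → E} {t : ℝ} (hc : ContDiffAt ℝ 2 c t) :
    HasDerivAt (deriv c) (deriv (deriv c) t) t := by
  refine DifferentiableAt.hasDerivAt ?_
  have h : deriv c = fun s ↦ fderiv ℝ c s 1 := funext fun s ↦ fderiv_apply_one_eq_deriv.symm
  rw [h]
  exact (hasFDerivAt_fderiv_of_contDiffAt hc).differentiableAt.clm_apply (differentiableAt_const _)

/-- The second derivative of the image of a curve by a map. -/
theorem deriv_deriv_comp {ψ : E → F} {c : ℝ → E} {t : ℝ} (hψ : ContDiffAt ℝ 2 ψ (c t))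
    (hc : ContDiffAt ℝ 2 c t) :
    deriv (fun s ↦ ψ (c s)) t = fderiv ℝ ψ (c t) (deriv c t) ∧
    deriv (deriv fun s ↦ ψ (c s)) t
      = fderiv ℝ (fderiv ℝ ψ) (c t) (deriv c t) (deriv c t)
        + fderiv ℝ ψ (c t) (deriv (deriv c) t) := by
  have hd : deriv (fun s ↦ ψ (c s)) =ᶠ[𝓝 t] fun s ↦ fderiv ℝ ψ (c s) (deriv c s) := by
    have h1 : ∀ᶠ q in 𝓝 (c t), DifferentiableAt ℝ ψ q :=
      (hψ.eventually (by simp)).mono fun q hq ↦ hq.differentiableAt (by simp)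
    have h2 : ∀ᶠ s in 𝓝 t, DifferentiableAt ℝ c s :=
      (hc.eventually (by simp)).mono fun s hs ↦ hs.differentiableAt (by simp)
    filter_upwards [hc.continuousAt.eventually h1, h2] with s hs1 hs2
    exact (hs1.hasFDerivAt.comp_hasDerivAt s hs2.hasDerivAt).deriv
  have hc1 : HasDerivAt c (deriv c t) t := (hc.differentiableAt (by simp)).hasDerivAt
  have hc2 := hasDerivAt_deriv_of_contDiffAt hc
  have hdd : HasDerivAt (fun s ↦ fderiv ℝ ψ (c s) (deriv c s)) _ t :=
    ((hasFDerivAt_fderiv_of_contDiffAt hψ).comp_hasDerivAt t hc1).clm_apply hc2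
  exact ⟨hd.eq_of_nhds, by rw [hd.deriv_eq, hdd.deriv]; rfl⟩

end SecondDerivatives

/-! ### Geodesics in charts: invariance, existence -/

section GeodesicEquation
variable {n : ℕ} {M : Type*} [TopologicalSpace M] [ChartedSpace (Model n) M]
  [IsManifold (𝓡 n) ∞ M]

/-- The derivative of the transformation law of the metric coefficients. -/
theorem fderiv_metricForm_transition (g : Metric n M) {x₀ x₁ : M} {q : Model n}
    (hq : q ∈ (extChartAt (𝓡 n) x₀).target)
    (h₁ : coordInv x₀ q ∈ (chartAt (Model n) x₁).source) (u v w : Model n) :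
    fderiv ℝ (metricForm g x₀) q u v w
      = fderiv ℝ (metricForm g x₁) (transition x₀ x₁ q)
          (fderiv ℝ (transition (n := n) x₀ x₁) q u)
          (fderiv ℝ (transition (n := n) x₀ x₁) q v) (fderiv ℝ (transition (n := n) x₀ x₁) q w)
        + metricForm g x₁ (transition x₀ x₁ q)
          (fderiv ℝ (fderiv ℝ (transition (n := n) x₀ x₁)) q u v)
          (fderiv ℝ (transition (n := n) x₀ x₁) q w)
        + metricForm g x₁ (transition x₀ x₁ q) (fderiv ℝ (transition (n := n) x₀ x₁) q v)
          (fderiv ℝ (fderiv ℝ (transition (n := n) x₀ x₁)) q u w) := by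
  have hT : transition x₀ x₁ q ∈ (extChartAt (𝓡 n) x₁).target := coord_mem_target h₁
  have hev : (fun q' ↦ metricCoeff g x₀ q' v w) =ᶠ[𝓝 q] fun q' ↦
      metricForm g x₁ (transition x₀ x₁ q') (fderiv ℝ (transition (n := n) x₀ x₁) q' v)
        (fderiv ℝ (transition (n := n) x₀ x₁) q' w) := by
    have hc : ContinuousAt (coordInv (n := n) x₀) q := continuousAt_extChartAt_symm'' hq
    filter_upwards [(isOpen_extChartAt_target x₀).mem_nhds hq,
      hc.preimage_mem_nhds ((chartAt (Model n) x₁).open_source.mem_nhds h₁)] with q' hq' h'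
    exact metricForm_transition g hq' h' v w
  rw [← fderiv_metricCoeff g hq, hev.fderiv_eq]
  exact fderiv_pullback ((contDiffAt_transition hq h₁).of_le two_le_infty)
    (differentiableAt_metricForm g hT) u v w

/-- The transformation law of the Christoffel symbols of the first kind. -/
theorem christoffel_transition (g : Metric n M) {x₀ x₁ : M} {q : Model n}
    (hq : q ∈ (extChartAt (𝓡 n) x₀).target)
    (h₁ : coordInv x₀ q ∈ (chartAt (Model n) x₁).source) (u v w : Model n) :
    christoffel g x₀ q u v w
      = christoffel g x₁ (transition x₀ x₁ q) (fderiv ℝ (transition (n := n) x₀ x₁) q u)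
          (fderiv ℝ (transition (n := n) x₀ x₁) q v) (fderiv ℝ (transition (n := n) x₀ x₁) q w)
        + metricCoeff g x₁ (transition x₀ x₁ q)
          (fderiv ℝ (fderiv ℝ (transition (n := n) x₀ x₁)) q u v)
          (fderiv ℝ (transition (n := n) x₀ x₁) q w) := by
  have hT : transition x₀ x₁ q ∈ (extChartAt (𝓡 n) x₁).target := coord_mem_target h₁
  have hs : ∀ a b, fderiv ℝ (fderiv ℝ (transition (n := n) x₀ x₁)) q a b
      = fderiv ℝ (fderiv ℝ (transition (n := n) x₀ x₁)) q b a :=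
    (contDiffAt_transition hq h₁).isSymmSndFDerivAt
      (by simpa only [minSmoothness_of_isRCLikeNormedField] using two_le_infty)
  have hm : ∀ a b, metricForm g x₁ (transition x₀ x₁ q) a b
      = metricForm g x₁ (transition x₀ x₁ q) b a := metricCoeff_symm g x₁ _
  rw [← christoffelForm_apply g hq, ← christoffelForm_apply g hT, ← metricForm_apply]
  simp only [christoffelForm, _root_.smul_apply, _root_.add_apply, _root_.sub_apply,
    ContinuousLinearMap.flip_apply, smul_eq_mul, fderiv_metricForm_transition g hq h₁]
  rw [hs v u, hs w u, hs w v, hm (fderiv ℝ (fderiv ℝ (transition (n := n) x₀ x₁)) q u w)]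
  ring

/-- The left-hand side of the geodesic equation transforms as a covector. -/
theorem geodesic_transition (g : Metric n M) {x₀ x₁ : M} {c : ℝ → Model n} {t : ℝ}
    (hq : c t ∈ (extChartAt (𝓡 n) x₀).target)
    (h₁ : coordInv x₀ (c t) ∈ (chartAt (Model n) x₁).source) (hc : ContDiffAt ℝ 2 c t)
    (w : Model n) :
    metricCoeff g x₁ (transition x₀ x₁ (c t))
        (deriv (deriv fun s ↦ transition (n := n) x₀ x₁ (c s)) t)
        (fderiv ℝ (transition (n := n) x₀ x₁) (c t) w)
      + christoffel g x₁ (transition x₀ x₁ (c t))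
        (deriv (fun s ↦ transition (n := n) x₀ x₁ (c s)) t)
        (deriv (fun s ↦ transition (n := n) x₀ x₁ (c s)) t)
        (fderiv ℝ (transition (n := n) x₀ x₁) (c t) w)
      = metricCoeff g x₀ (c t) (deriv (deriv c) t) w
        + christoffel g x₀ (c t) (deriv c t) (deriv c t) w := by
  obtain ⟨h1, h2⟩ := deriv_deriv_comp ((contDiffAt_transition hq h₁).of_le two_le_infty) hc
  rw [h1, h2, christoffel_transition g hq h₁, ← metricForm_apply, ← metricForm_apply,
    ← metricForm_apply, map_add, metricForm_transition g hq h₁]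
  simp only [_root_.add_apply]
  ring

/-- The transition map is a local diffeomorphism: its differential is injective because it is an
isometry for the coordinate expressions of the metric. -/
theorem surjective_fderiv_transition (g : Metric n M) {x₀ x₁ : M} {q : Model n}
    (hq : q ∈ (extChartAt (𝓡 n) x₀).target)
    (h₁ : coordInv x₀ q ∈ (chartAt (Model n) x₁).source) :
    Function.Surjective (fderiv ℝ (transition (n := n) x₀ x₁) q) := by
  refine (LinearMap.injective_iff_surjective
    (f := (fderiv ℝ (transition (n := n) x₀ x₁) q).toLinearMap)).1 ?_
  rw [injective_iff_map_eq_zero]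
  intro u hu
  by_contra hne
  have h := metricCoeff_pos g hq hne
  have hu' : fderiv ℝ (transition (n := n) x₀ x₁) q u = 0 := hu
  rw [← metricForm_apply, metricForm_transition g hq h₁, hu', map_zero] at h
  exact lt_irrefl _ h

theorem contDiffAt_coord_comp {γ : ℝ → M} {J : Set ℝ} (hJ : IsOpen J)
    (hγ : ContMDiffOn 𝓘(ℝ, ℝ) (𝓡 n) 2 γ J) {t : ℝ} (ht : t ∈ J) {x₀ : M}
    (hx : γ t ∈ (chartAt (Model n) x₀).source) :
    ContDiffAt ℝ 2 (fun s ↦ coord (n := n) x₀ (γ s)) t := by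
  rw [← contMDiffAt_iff_contDiffAt]
  exact (contMDiffAt_extChartAt' (n := 2) hx).comp t (hγ.contMDiffAt (hJ.mem_nhds ht))

/-- The acceleration prescribed by the geodesic equation. -/
noncomputable def acceleration (g : Metric n M) (x₀ : M) (q u : Model n) : Model n :=
  WithLp.toLp 2 (-(connectionMatrix g x₀ q u *ᵥ u.ofLp))

/-- The geodesic equation, solved for the second derivative. -/
theorem geodesic_eq_iff (g : Metric n M) {x₀ : M} {q : Model n}
    (hq : q ∈ (extChartAt (𝓡 n) x₀).target) (a u : Model n) :
    (∀ w, metricCoeff g x₀ q a w + christoffel g x₀ q u u w = 0)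
      ↔ a = acceleration g x₀ q u := by
  have h1 : ∀ w, metricCoeff g x₀ q (acceleration g x₀ q u) w = -christoffel g x₀ q u u w := by
    intro w
    rw [metricCoeff_symm, metricCoeff_eq_dotProduct, acceleration, Matrix.mulVec_neg,
      dotProduct_neg, dotProduct_connectionMatrix g hq]
  constructor
  · intro h
    refine WithLp.ofLp_injective 2 (eq_of_forall_dotProduct_gramIn g hq fun w ↦ ?_)
    rw [← metricCoeff_eq_dotProduct, ← metricCoeff_eq_dotProduct, metricCoeff_symm,
      metricCoeff_symm g x₀ q w, h1]
    linarith [h w]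
  · rintro rfl w
    rw [h1]
    ring

theorem contDiffOn_acceleration (g : Metric n M) (x₀ : M) :
    ContDiffOn ℝ ∞ (fun z : Model n × Model n ↦ acceleration g x₀ z.1 z.2)
      ((extChartAt (𝓡 n) x₀).target ×ˢ Set.univ) := by
  have hU : IsOpen (extChartAt (𝓡 n) x₀).target := isOpen_extChartAt_target x₀
  have hfst : Set.MapsTo (Prod.fst : Model n × Model n → Model n)
      ((extChartAt (𝓡 n) x₀).target ×ˢ Set.univ) (extChartAt (𝓡 n) x₀).target := fun z hz ↦ hz.1
  have hC : ∀ i j, ContDiffOn ℝ ∞ (fun z : Model n × Model n ↦ christoffelForm g x₀ z.1 z.2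
      (EuclideanSpace.single j 1) (EuclideanSpace.single i 1))
      ((extChartAt (𝓡 n) x₀).target ×ˢ Set.univ) := by
    intro i j
    simp only [christoffelForm, _root_.smul_apply, _root_.add_apply, _root_.sub_apply,
      ContinuousLinearMap.flip_apply]
    have hB := contDiffOn_metricForm g x₀
    exact contDiffOn_const.mul
      (((contDiffOn_fderiv_apply₃ hU hB contDiff_snd contDiff_const contDiff_const).add
      (contDiffOn_fderiv_apply₃ hU hB contDiff_const contDiff_snd contDiff_const)).sub
      (contDiffOn_fderiv_apply₃ hU hB contDiff_const contDiff_snd contDiff_const))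
  have hG : ContDiffOn ℝ ∞ (fun z : Model n × Model n ↦ connectionMatrix g x₀ z.1 z.2)
      ((extChartAt (𝓡 n) x₀).target ×ˢ Set.univ) :=
    ((contDiffOn_matrix_inv (contDiffOn_gramIn g x₀) fun q hq ↦ det_gramIn_pos g hq).comp
      contDiffOn_fst hfst).mul (contDiffOn_matrix_iff.2 hC)
  rw [contDiffOn_matrix_iff] at hG
  rw [contDiffOn_euclidean]
  intro i
  change ContDiffOn ℝ ∞ (fun z : Model n × Model n ↦
    -∑ j, connectionMatrix g x₀ z.1 z.2 i j * z.2 j) _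
  refine (ContDiffOn.sum fun j _ ↦ (hG i j).mul ?_).neg
  exact ((EuclideanSpace.proj j : Model n →L[ℝ] ℝ).contDiff.comp contDiff_snd).contDiffOn

/-- The existence of a geodesic with given initial position and velocity. -/
theorem exists_isGeodesicOn (g : Metric n M) {x₀ : M} {q : Model n}
    (hq : q ∈ (extChartAt (𝓡 n) x₀).target) (u : Model n) :
    ∃ (J : Set ℝ) (γ : ℝ → M), IsOpen J ∧ J.OrdConnected ∧ (0 : ℝ) ∈ J ∧ IsGeodesicOn g γ J ∧
      γ 0 = coordInv x₀ q ∧ deriv (fun s ↦ coord (n := n) x₀ (γ s)) 0 = u := by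
  set U := (extChartAt (𝓡 n) x₀).target with hU
  have hUo : IsOpen U := isOpen_extChartAt_target x₀
  set f : Model n × Model n → Model n × Model n := fun z ↦ (z.2, acceleration g x₀ z.1 z.2) with hf
  have hfs : ContDiffOn ℝ ∞ f (U ×ˢ Set.univ) :=
    contDiffOn_snd.prodMk (contDiffOn_acceleration g x₀)
  have hfa : ContDiffAt ℝ 1 f (q, u) :=
    (hfs.contDiffAt ((hUo.prod isOpen_univ).mem_nhds ⟨hq, trivial⟩)).of_le (by simp)
  obtain ⟨α, hα0, ε, hε, hα⟩ :=
    hfa.exists_forall_mem_closedBall_exists_eq_forall_mem_Ioo_hasDerivAt₀ 0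
  have h0 : (0 : ℝ) ∈ Set.Ioo (0 - ε) (0 + ε) := ⟨by linarith, by linarith⟩
  have hcont : ContinuousAt (fun t ↦ (α t).1) 0 := (hα 0 h0).continuousAt.fst
  have hnear : ∀ᶠ t in 𝓝 (0 : ℝ), (α t).1 ∈ U :=
    hcont.eventually_mem (hUo.mem_nhds (by rw [hα0]; exact hq))
  obtain ⟨δ, hδ, hball⟩ := Metric.eventually_nhds_iff_ball.1
    (hnear.and (Ioo_mem_nhds h0.1 h0.2))
  set J := Metric.ball (0 : ℝ) δ with hJ
  have hJo : IsOpen J := Metric.isOpen_ball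
  have hαJ : ∀ t ∈ J, HasDerivAt α (f (α t)) t := fun t ht ↦ hα t (hball t ht).2
  have hmaps : Set.MapsTo α J (U ×ˢ Set.univ) := fun t ht ↦ ⟨(hball t ht).1, trivial⟩
  -- The solution of the differential equation gains one derivative at a time from the smoothness of
  -- its right-hand side.
  have hstep : ∀ k : ℕ, ContDiffOn ℝ k α J := by
    intro k
    induction k with
    | zero =>
      exact contDiffOn_zero.2 fun t ht ↦ (hαJ t ht).continuousAt.continuousWithinAt
    | succ k ih =>
      have h := (contDiffOn_succ_iff_deriv_of_isOpen (n := (k : ℕ∞ω)) hJo).2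
        ⟨fun t ht ↦ (hαJ t ht).differentiableAt.differentiableWithinAt, by simp,
          ((hfs.of_le (m := (k : ℕ∞ω)) (by exact_mod_cast le_top)).comp ih hmaps).congr
            fun t ht ↦ (hαJ t ht).deriv⟩
      exact_mod_cast h
  set c : ℝ → Model n := fun t ↦ (α t).1 with hc
  have hcC : ContDiffOn ℝ 2 c J := (hstep 2).fst
  have hcU : ∀ t ∈ J, c t ∈ U := fun t ht ↦ (hball t ht).1
  have hc1 : ∀ t ∈ J, HasDerivAt c (α t).2 t := fun t ht ↦ (hαJ t ht).fst
  have hc2 : ∀ t ∈ J, deriv (deriv c) t = acceleration g x₀ (c t) (deriv c t) := by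
    intro t ht
    have h : deriv c =ᶠ[𝓝 t] fun s ↦ (α s).2 := by
      filter_upwards [hJo.mem_nhds ht] with s hs
      exact (hc1 s hs).deriv
    have h2 : HasDerivAt (fun s ↦ (α s).2) (acceleration g x₀ (α t).1 (α t).2) t := (hαJ t ht).snd
    rw [h.deriv_eq, h2.deriv, (hc1 t ht).deriv]
  have h0J : (0 : ℝ) ∈ J := Metric.mem_ball_self hδ
  refine ⟨J, fun t ↦ coordInv x₀ (c t), hJo, (convex_ball _ _).ordConnected, h0J,
    ⟨?_, ?_⟩, by simp [hc, hα0], ?_⟩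
  · exact ((contMDiffOn_extChartAt_symm (n := 2) x₀).comp hcC.contMDiffOn hcU)
  · intro t ht x₁ hx₁ w
    obtain ⟨w, rfl⟩ := surjective_fderiv_transition g (hcU t ht) hx₁ w
    -- The equation holds in the chart around `x₀`, hence in every chart.
    have h := geodesic_transition g (hcU t ht) hx₁ (hcC.contDiffAt (hJo.mem_nhds ht)) w
    exact h.trans ((geodesic_eq_iff g (hcU t ht) _ _).2 (hc2 t ht) w)
  · have h : (fun s ↦ coord (n := n) x₀ (coordInv x₀ (c s))) =ᶠ[𝓝 0] c := by
      filter_upwards [hJo.mem_nhds h0J] with s hs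
      exact coord_coordInv (hcU s hs)
    rw [h.deriv_eq, (hc1 0 h0J).deriv, hα0]

theorem IsGeodesicOn.deriv_deriv {g : Metric n M} {γ : ℝ → M} {J : Set ℝ}
    (h : IsGeodesicOn g γ J) {t : ℝ} (ht : t ∈ J) {x₀ : M}
    (hx : γ t ∈ (chartAt (Model n) x₀).source) :
    deriv (deriv fun s ↦ coord (n := n) x₀ (γ s)) t
      = acceleration g x₀ (coord x₀ (γ t)) (deriv (fun s ↦ coord x₀ (γ s)) t) :=
  (geodesic_eq_iff g (coord_mem_target hx) _ _).1 (h.geodesic_eq t ht x₀ hx)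

end GeodesicEquation

/-! ### Levi-Civita's relation -/

section ProjectiveRelation
variable {n : ℕ} {M : Type*} [TopologicalSpace M] [ChartedSpace (Model n) M]
  [IsManifold (𝓡 n) ∞ M]

theorem connectionMatrix_smul (g : Metric n M) {x₀ : M} {q : Model n}
    (hq : q ∈ (extChartAt (𝓡 n) x₀).target) (a : ℝ) (u v : Model n) :
    connectionMatrix g x₀ q (a • u) *ᵥ v.ofLp = a • (connectionMatrix g x₀ q u *ᵥ v.ofLp) := by
  rw [connectionMatrix_symm g hq, WithLp.ofLp_smul, Matrix.mulVec_smul,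
    connectionMatrix_symm g hq v u]

theorem connectionMatrix_add (g : Metric n M) {x₀ : M} {q : Model n}
    (hq : q ∈ (extChartAt (𝓡 n) x₀).target) (u u' v : Model n) :
    connectionMatrix g x₀ q (u + u') *ᵥ v.ofLp
      = connectionMatrix g x₀ q u *ᵥ v.ofLp + connectionMatrix g x₀ q u' *ᵥ v.ofLp := by
  rw [connectionMatrix_symm g hq, WithLp.ofLp_add, Matrix.mulVec_add,
    connectionMatrix_symm g hq v u, connectionMatrix_symm g hq v u']

/-- For a curve, the second Fréchet derivative is given by the ordinary second derivative. -/
theorem fderiv_fderiv_apply_real {E : Type*} [NormedAddCommGroup E] [NormedSpace ℝ E] {c : ℝ → E}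
    {t : ℝ} (hc : ContDiffAt ℝ 2 c t) (a b : ℝ) :
    fderiv ℝ (fderiv ℝ c) t a b = (a * b) • deriv (deriv c) t := by
  have h := (deriv_deriv_comp (c := fun s : ℝ ↦ s) hc contDiffAt_id).2
  have h1 : deriv (fun s : ℝ ↦ s) = fun _ ↦ 1 := funext fun s ↦ deriv_id s
  rw [h1, deriv_const, map_zero, add_zero] at h
  have h2 : fderiv ℝ (fderiv ℝ c) t a b = fderiv ℝ (fderiv ℝ c) t (a • 1) (b • 1) := by
    rw [smul_eq_mul, smul_eq_mul, mul_one, mul_one]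
  rw [h2, map_smul, map_smul, _root_.smul_apply, ← h, smul_smul, mul_comm]

/-- The connections of geodesically equivalent metrics have proportional accelerations: this is
the geodesic equation of `g` for a reparameterized geodesic of `g'`. -/
theorem GeodesicallyEquivalent.connectionMatrix_parallel {g g' : Metric n M}
    (h : GeodesicallyEquivalent g g') {x₀ : M} {q : Model n}
    (hq : q ∈ (extChartAt (𝓡 n) x₀).target) (u : Model n) :
    ∃ k : ℝ, connectionMatrix g' x₀ q u *ᵥ u.ofLp - connectionMatrix g x₀ q u *ᵥ u.ofLp
      = k • u.ofLp := by
  obtain ⟨J, γ, hJo, hJc, h0, hγ, hγ0, hu⟩ := exists_isGeodesicOn g' hq u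
  obtain ⟨J', τ, hJ'o, -, hτ, hτC, hτ0, hγτ⟩ := h J γ hJo hJc hγ
  obtain ⟨s, hs, hs0⟩ := hτ.surjOn h0
  have hx : γ (τ s) ∈ (chartAt (Model n) x₀).source := by
    rw [hs0, hγ0]
    exact coordInv_mem_source hq
  have hx0 : γ 0 ∈ (chartAt (Model n) x₀).source := hs0 ▸ hx
  have hcoord : coord (n := n) x₀ (γ 0) = q := by rw [hγ0, coord_coordInv hq]
  have hτs : ContDiffAt ℝ 2 τ s := hτC.contDiffAt (hJ'o.mem_nhds hs)
  set c : ℝ → Model n := fun r ↦ coord (n := n) x₀ (γ r) with hc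
  have hcC : ContDiffAt ℝ 2 c 0 := contDiffAt_coord_comp hJo hγ.contMDiffOn h0 hx0
  have hacc' : deriv (deriv c) 0 = acceleration g' x₀ q u := by
    rw [hγ.deriv_deriv h0 hx0, hcoord, hu]
  have hacc := hγτ.deriv_deriv (x₀ := x₀) hs hx
  simp only [Function.comp_apply] at hacc
  rw [hs0, hcoord] at hacc
  rw [← hs0] at hcC
  obtain ⟨h1, h2⟩ := deriv_deriv_comp hcC hτs
  have h3 : ∀ a : ℝ, fderiv ℝ c (τ s) a = a • u := fun a ↦ by
    rw [fderiv_eq_smul_deriv, hs0, hu]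
  rw [h1, h2, fderiv_fderiv_apply_real hcC, h3, h3, hs0, hacc'] at hacc
  have h4 := congrArg WithLp.ofLp hacc
  simp only [acceleration, connectionMatrix_smul g hq, WithLp.ofLp_smul, WithLp.ofLp_add,
    Matrix.mulVec_smul] at h4
  set a := deriv τ s with ha
  have ha0 : a ≠ 0 := hτ0 s hs
  refine ⟨deriv (deriv τ) s / (a * a), ?_⟩
  -- With `a = τ'(s)`, the curve `c ∘ τ` has velocity `a u` and acceleration `a² c'' + τ'' u`.
  have h5 : (a * a) • (connectionMatrix g' x₀ q u *ᵥ u.ofLp - connectionMatrix g x₀ q u *ᵥ u.ofLp)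
      = deriv (deriv τ) s • u.ofLp := by
    have h6 : deriv (deriv τ) s • u.ofLp = ((a * a) • -(connectionMatrix g' x₀ q u *ᵥ u.ofLp)
        + deriv (deriv τ) s • u.ofLp) + (a * a) • (connectionMatrix g' x₀ q u *ᵥ u.ofLp) := by
      module
    rw [h6, h4]
    module
  rw [div_eq_inv_mul, mul_smul, ← h5, smul_smul, inv_mul_cancel₀ (mul_ne_zero ha0 ha0), one_smul]

/-- **Levi-Civita's relation** between the connections of geodesically equivalent metrics. -/
theorem GeodesicallyEquivalent.exists_connectionMatrix_eq {g g' : Metric n M}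
    (h : GeodesicallyEquivalent g g') {x₀ : M} {q : Model n}
    (hq : q ∈ (extChartAt (𝓡 n) x₀).target) :
    ∃ φ : Fin n → ℝ, ∀ u : Model n, connectionMatrix g' x₀ q u
      = connectionMatrix g x₀ q u + (φ ⬝ᵥ u.ofLp) • (1 : Matrix (Fin n) (Fin n) ℝ)
        + vecMulVec u.ofLp φ := by
  let D : (Fin n → ℝ) →ₗ[ℝ] (Fin n → ℝ) →ₗ[ℝ] (Fin n → ℝ) := LinearMap.mk₂ ℝ
    (fun u v ↦ connectionMatrix g' x₀ q (WithLp.toLp 2 u) *ᵥ v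
      - connectionMatrix g x₀ q (WithLp.toLp 2 u) *ᵥ v)
    (fun u u' v ↦ by
      have h1 := connectionMatrix_add g hq (WithLp.toLp 2 u) (WithLp.toLp 2 u') (WithLp.toLp 2 v)
      have h2 := connectionMatrix_add g' hq (WithLp.toLp 2 u) (WithLp.toLp 2 u') (WithLp.toLp 2 v)
      simp only [WithLp.toLp_add] at h1 h2 ⊢
      rw [h1, h2]
      abel)
    (fun a u v ↦ by
      have h1 := connectionMatrix_smul g hq a (WithLp.toLp 2 u) (WithLp.toLp 2 v)
      have h2 := connectionMatrix_smul g' hq a (WithLp.toLp 2 u) (WithLp.toLp 2 v)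
      simp only [WithLp.toLp_smul] at h1 h2 ⊢
      rw [h1, h2, smul_sub])
    (fun u v v' ↦ by
      rw [Matrix.mulVec_add, Matrix.mulVec_add]
      abel)
    (fun a u v ↦ by rw [Matrix.mulVec_smul, Matrix.mulVec_smul, smul_sub])
  obtain ⟨φ, hφ⟩ := exists_linear_of_parallel D
    (fun u v ↦ congrArg₂ (· - ·)
      (connectionMatrix_symm g' hq (WithLp.toLp 2 u) (WithLp.toLp 2 v))
      (connectionMatrix_symm g hq (WithLp.toLp 2 u) (WithLp.toLp 2 v)))
    (fun u ↦ h.connectionMatrix_parallel hq (WithLp.toLp 2 u))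
  have hφv : ∀ v : Fin n → ℝ, (fun i ↦ φ (Pi.single i 1)) ⬝ᵥ v = φ v := by
    intro v
    conv_rhs => rw [← Finset.univ_sum_single v]
    rw [map_sum]
    refine Finset.sum_congr rfl fun i _ ↦ ?_
    have h1 : Pi.single i (v i) = v i • (Pi.single i 1 : Fin n → ℝ) := by
      rw [← Pi.single_smul, smul_eq_mul, mul_one]
    rw [h1, map_smul, smul_eq_mul, mul_comm]
  refine ⟨fun i ↦ φ (Pi.single i 1), fun u ↦ Matrix.mulVec_injective (funext fun v ↦ ?_)⟩
  have h1 : connectionMatrix g' x₀ q u *ᵥ v - connectionMatrix g x₀ q u *ᵥ v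
      = φ u.ofLp • v + φ v • u.ofLp := hφ u.ofLp v
  rw [Matrix.add_mulVec, Matrix.add_mulVec, Matrix.smul_mulVec, Matrix.one_mulVec,
    Matrix.vecMulVec_mulVec, hφv, hφv, op_smul_eq_smul, add_assoc, ← h1]
  abel

end ProjectiveRelation

/-! ### Conservation along geodesics -/

section Integral
variable {n : ℕ} {M : Type*} [TopologicalSpace M] [ChartedSpace (Model n) M]
  [IsManifold (𝓡 n) ∞ M]

theorem contDiff_ofLp : ContDiff ℝ ∞ (fun u : Model n ↦ u.ofLp) :=
  contDiff_pi.2 fun i ↦ (EuclideanSpace.proj i : Model n →L[ℝ] ℝ).contDiff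

/-- The fibre coordinate of the tangent bundle is the differential of the chart. -/
theorem trivializationAt_snd {x₀ : M} {v : TangentBundle (𝓡 n) M}
    (hx : v.proj ∈ (chartAt (Model n) x₀).source) :
    (trivializationAt (Model n) (fun x : M ↦ TangentSpace (𝓡 n) x) x₀ v).2
      = dCoord x₀ v.proj v.snd := by
  have h2 := DFunLike.congr_fun
    (TangentBundle.continuousLinearMapAt_trivializationAt (I := 𝓡 n) hx) v.snd
  rw [Bundle.Trivialization.continuousLinearMapAt_apply, Bundle.Trivialization.linearMapAt_apply,
    if_pos (by rwa [TangentBundle.trivializationAt_baseSet])] at h2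
  exact h2

theorem contMDiff_integral (g g' : Metric n M) (t : ℝ) :
    ContMDiff (𝓡 n).tangent 𝓘(ℝ, ℝ) ∞ (integral g g' t) := by
  intro v₀
  set x₀ : M := v₀.proj with hx₀
  set e := trivializationAt (Model n) (fun x : M ↦ TangentSpace (𝓡 n) x) x₀ with he
  have hsrc : v₀.proj ∈ (chartAt (Model n) x₀).source := mem_chart_source _ _
  set H : Model n × Model n → ℝ := fun z ↦
    integralForm (gramIn g x₀ z.1) (gramIn g' x₀ z.1) t z.2.ofLp with hH
  have hHs : ContDiffOn ℝ ∞ H ((extChartAt (𝓡 n) x₀).target ×ˢ Set.univ) :=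
    contDiffOn_integralForm ((contDiffOn_gramIn g x₀).comp contDiffOn_fst fun _ hz ↦ hz.1)
      ((contDiffOn_gramIn g' x₀).comp contDiffOn_fst fun _ hz ↦ hz.1)
      (fun _ hz ↦ det_gramIn_pos g hz.1) (fun _ hz ↦ det_gramIn_pos g' hz.1)
      (contDiff_ofLp.comp contDiff_snd).contDiffOn t
  have hz : (coord x₀ v₀.proj, (e v₀).2) ∈
      (extChartAt (𝓡 n) x₀).target ×ˢ (Set.univ : Set (Model n)) :=
    ⟨coord_mem_target hsrc, trivial⟩
  have hHa : ContMDiffAt 𝓘(ℝ, Model n × Model n) 𝓘(ℝ, ℝ) ∞ H (coord x₀ v₀.proj, (e v₀).2) :=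
    (hHs.contDiffAt (((isOpen_extChartAt_target x₀).prod isOpen_univ).mem_nhds hz)).contMDiffAt
  have h1 : ContMDiffAt (𝓡 n).tangent 𝓘(ℝ, Model n) ∞
      (fun v : TangentBundle (𝓡 n) M ↦ coord (n := n) x₀ v.proj) v₀ :=
    (contMDiffAt_extChartAt' hsrc).comp v₀ (Bundle.contMDiff_proj _).contMDiffAt
  have h2 : ContMDiffAt (𝓡 n).tangent 𝓘(ℝ, Model n) ∞
      (fun v : TangentBundle (𝓡 n) M ↦ (e v).2) v₀ := by
    have h3 := (e.contMDiffAt_iff (f := id) (x₀ := v₀) (n := ∞) (IM := (𝓡 n).tangent) (IB := 𝓡 n)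
      (FiberBundle.mem_trivializationAt_proj_source)).1 contMDiffAt_id
    exact h3.2
  refine (hHa.comp v₀ (h1.prodMk_space h2)).congr_of_eventuallyEq ?_
  have hcont : ContinuousAt (fun v : TangentBundle (𝓡 n) M ↦ v.proj) v₀ :=
    (FiberBundle.continuous_proj (Model n) (fun x : M ↦ TangentSpace (𝓡 n) x)).continuousAt
  filter_upwards [hcont.preimage_mem_nhds ((chartAt (Model n) x₀).open_source.mem_nhds hsrc)]
    with v hv
  have h4 := integral_eq_integralForm g g' t hv v.snd
  rw [← trivializationAt_snd hv] at h4
  exact h4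

/-- The coordinates of the velocity are the derivatives of the coordinates. -/
theorem dCoord_velocity {γ : ℝ → M} {J : Set ℝ} (hJ : IsOpen J)
    (hγ : ContMDiffOn 𝓘(ℝ, ℝ) (𝓡 n) 2 γ J) {t : ℝ} (ht : t ∈ J) {x₀ : M}
    (hx : γ t ∈ (chartAt (Model n) x₀).source) :
    dCoord x₀ (γ t) (mfderiv 𝓘(ℝ, ℝ) (𝓡 n) γ t (1 : ℝ))
      = deriv (fun s ↦ coord (n := n) x₀ (γ s)) t := by
  have h := mfderiv_comp (I := 𝓘(ℝ, ℝ)) (I' := 𝓡 n) (I'' := 𝓘(ℝ, Model n)) t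
    (f := γ) (g := coord (n := n) x₀)
    (mdifferentiableAt_extChartAt hx)
    ((hγ.contMDiffAt (hJ.mem_nhds ht)).mdifferentiableAt (by simp))
  rw [mfderiv_eq_fderiv] at h
  have h2 : fderiv ℝ (fun s ↦ coord (n := n) x₀ (γ s)) t 1
      = deriv (fun s ↦ coord (n := n) x₀ (γ s)) t := fderiv_apply_one_eq_deriv
  rw [← h2]
  exact (DFunLike.congr_fun h (1 : ℝ)).symm

/-- The conservation law in a chart. -/
theorem hasDerivAt_integralForm_geodesic {g g' : Metric n M} (h : GeodesicallyEquivalent g g')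
    (a : ℝ) {x₀ : M} {c : ℝ → Model n} {t : ℝ} (hq : c t ∈ (extChartAt (𝓡 n) x₀).target)
    (hc : ContDiffAt ℝ 2 c t) (hacc : deriv (deriv c) t = acceleration g x₀ (c t) (deriv c t)) :
    HasDerivAt (fun s ↦ integralForm (gramIn g x₀ (c s)) (gramIn g' x₀ (c s)) a
      (deriv c s).ofLp) 0 t := by
  have hc1 : HasDerivAt c (deriv c t) t := (hc.differentiableAt (by simp)).hasDerivAt
  have hc2 := hasDerivAt_deriv_of_contDiffAt hc
  obtain ⟨φ, hφ⟩ := h.exists_connectionMatrix_eq hq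
  have hu : HasDerivAt (fun s ↦ (deriv c s).ofLp)
      (-(connectionMatrix g x₀ (c t) (deriv c t) *ᵥ (deriv c t).ofLp)) t := by
    have hofLp : (acceleration g x₀ (c t) (deriv c t)).ofLp
        = -(connectionMatrix g x₀ (c t) (deriv c t) *ᵥ (deriv c t).ofLp) := rfl
    rw [← hofLp, ← hacc]
    generalize deriv (deriv c) t = b at hc2
    refine hasDerivAt_pi.2 fun i ↦ ?_
    exact (EuclideanSpace.proj i : Model n →L[ℝ] ℝ).hasFDerivAt.comp_hasDerivAt t hc2
  have hG := hasDerivAt_gramIn g hq hc1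
  have hG' := hasDerivAt_gramIn g' hq hc1
  have hC := hφ (deriv c t)
  exact hasDerivAt_integralForm (u := fun s ↦ (deriv c s).ofLp) (φ := φ)
    (C := connectionMatrix g x₀ (c t) (deriv c t)) (C' := connectionMatrix g' x₀ (c t) (deriv c t))
    hG hG' hC (transpose_gramIn g x₀ _) (transpose_gramIn g' x₀ _) (det_gramIn_pos g hq)
    (det_gramIn_pos g' hq) hu a

/-- Conservation of `I_t` on the manifold, read in a chart around the point of the curve. -/
theorem hasDerivAt_integral_velocity {g g' : Metric n M} (h : GeodesicallyEquivalent g g') (a : ℝ)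
    {γ : ℝ → M} {J : Set ℝ} (hJ : IsOpen J) (hγ : IsGeodesicOn g γ J) {t : ℝ} (ht : t ∈ J) {x₀ : M}
    (hsrc : γ t ∈ (chartAt (Model n) x₀).source) :
    HasDerivAt (fun s ↦ integral g g' a (velocity γ s)) 0 t := by
  have hev : (fun s ↦ integral g g' a (velocity γ s)) =ᶠ[𝓝 t] fun s ↦
      integralForm (gramIn g x₀ (coord x₀ (γ s))) (gramIn g' x₀ (coord x₀ (γ s))) a
        (deriv (fun s ↦ coord (n := n) x₀ (γ s)) s).ofLp := by
    have hcont : ContinuousAt γ t := (hγ.contMDiffOn.contMDiffAt (hJ.mem_nhds ht)).continuousAt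
    filter_upwards [hJ.mem_nhds ht,
      hcont.preimage_mem_nhds ((chartAt (Model n) x₀).open_source.mem_nhds hsrc)] with s hs hs'
    rw [← dCoord_velocity hJ hγ.contMDiffOn hs hs']
    exact integral_eq_integralForm g g' a hs' (mfderiv 𝓘(ℝ, ℝ) (𝓡 n) γ s (1 : ℝ))
  refine HasDerivAt.congr_of_eventuallyEq ?_ hev
  exact hasDerivAt_integralForm_geodesic h a (c := fun s ↦ coord (n := n) x₀ (γ s))
    (coord_mem_target hsrc) (contDiffAt_coord_comp hJ hγ.contMDiffOn ht hsrc)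
    (hγ.deriv_deriv ht hsrc)

theorem isGeodesicIntegral_integral {g g' : Metric n M} (h : GeodesicallyEquivalent g g') (a : ℝ) :
    IsGeodesicIntegral g (integral g g' a) where
  contMDiff := contMDiff_integral g g' a
  const J γ hJ hJc hγ s hs t ht := by
    have hd := fun r (hr : r ∈ J) ↦ hasDerivAt_integral_velocity h a hJ hγ hr
      (mem_chart_source _ (γ r))
    exact hJ.is_const_of_deriv_eq_zero hJc.isPreconnected
      (fun r hr ↦ (hd r hr).differentiableAt.differentiableWithinAt)
      (fun r hr ↦ (hd r hr).deriv) hs ht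

end Integral

/-! ### Commutation -/

section Poisson
variable {n : ℕ} {M : Type*} [TopologicalSpace M] [ChartedSpace (Model n) M]
  [IsManifold (𝓡 n) ∞ M]

/-- The components of a covector on `ℝⁿ`. -/
noncomputable def covectorCoeff : (Model n →L[ℝ] ℝ) →L[ℝ] (Fin n → ℝ) :=
  ContinuousLinearMap.pi fun i ↦ ContinuousLinearMap.apply ℝ ℝ (EuclideanSpace.single i (1 : ℝ))

theorem covectorCoeff_apply (p : Model n →L[ℝ] ℝ) (i : Fin n) :
    covectorCoeff p i = p (EuclideanSpace.single i 1) := rfl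

/-- The function `I_t` in the canonical coordinates of the cotangent bundle. -/
noncomputable def hamiltonian (g g' : Metric n M) (x₀ : M) (t : ℝ)
    (z : Model n × (Model n →L[ℝ] ℝ)) : ℝ :=
  ((adjugateMatrix (gramIn g x₀ z.1) (gramIn g' x₀ z.1) t * (gramIn g x₀ z.1)⁻¹)
    *ᵥ covectorCoeff z.2) ⬝ᵥ covectorCoeff z.2

/-- The coordinate expression of `I_t ∘ sharp` is `hamiltonian`, in any chart. -/
theorem integral_sharp_cotangentCoordInv (g g' : Metric n M) {x₀ : M} (t : ℝ)
    {z : Model n × (Model n →L[ℝ] ℝ)} (hz : z.1 ∈ (extChartAt (𝓡 n) x₀).target) :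
    integral g g' t (sharp g (cotangentCoordInv x₀ z)) = hamiltonian g g' x₀ t z := by
  obtain ⟨q, p⟩ := z
  change q ∈ _ at hz
  set α : TangentSpace (𝓡 n) (coordInv x₀ q) →L[ℝ] ℝ := p ∘L dCoord x₀ (coordInv x₀ q) with hα
  set v : TangentSpace (𝓡 n) (coordInv x₀ q) := (g.inner (coordInv x₀ q)).inverse α with hv
  have hgv : g.inner (coordInv x₀ q) v = α :=
    (((isInvertible_inner g (coordInv x₀ q)).inverse_apply_eq (x := v) (y := α)).1 rfl).symm
  set y : Model n := dCoord x₀ (coordInv x₀ q) v with hy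
  have hr : gramIn g x₀ q * (gramIn g x₀ q)⁻¹ = 1 :=
    Matrix.mul_nonsing_inv _ (det_gramIn_pos g hz).ne'.isUnit
  have hl : (gramIn g x₀ q)⁻¹ * gramIn g x₀ q = 1 :=
    Matrix.nonsing_inv_mul _ (det_gramIn_pos g hz).ne'.isUnit
  have h1 : gramIn g x₀ q *ᵥ y.ofLp = covectorCoeff p := by
    ext i
    have h2 := metricCoeff_eq_dotProduct g x₀ q (EuclideanSpace.single i 1) y
    have hyv : dCoordInv x₀ q y = v := dCoordInv_dCoord hz v
    rw [metricCoeff_symm, metricCoeff, hyv, hgv, hα] at h2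
    have h3 : (p ∘L dCoord x₀ (coordInv x₀ q)) (dCoordInv x₀ q (EuclideanSpace.single i 1))
        = covectorCoeff p i := by
      rw [ContinuousLinearMap.comp_apply, dCoord_dCoordInv hz]
      rfl
    rw [h3] at h2
    rw [h2]
    simp
  have h2 : y.ofLp = (gramIn g x₀ q)⁻¹ *ᵥ covectorCoeff p := by
    rw [← h1, Matrix.mulVec_mulVec, hl, Matrix.one_mulVec]
  have h3 := integral_eq_integralForm g g' t (coordInv_mem_source hz) v
  rw [coord_coordInv hz, ← hy, h2, integralForm, Matrix.mulVec_mulVec, Matrix.mulVec_mulVec, hr,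
    Matrix.one_mulVec] at h3
  exact h3

theorem differentiableAt_hamiltonian (g g' : Metric n M) {x₀ : M} (t : ℝ)
    {z : Model n × (Model n →L[ℝ] ℝ)} (hz : z.1 ∈ (extChartAt (𝓡 n) x₀).target) :
    DifferentiableAt ℝ (hamiltonian g g' x₀ t) z := by
  have hU : IsOpen ((extChartAt (𝓡 n) x₀).target ×ˢ (Set.univ : Set (Model n →L[ℝ] ℝ))) :=
    (isOpen_extChartAt_target x₀).prod isOpen_univ
  have hp : ContDiffOn ℝ ∞ (fun z : Model n × (Model n →L[ℝ] ℝ) ↦ covectorCoeff z.2)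
      ((extChartAt (𝓡 n) x₀).target ×ˢ Set.univ) :=
    (covectorCoeff.contDiff.comp contDiff_snd).contDiffOn
  have h1 := contDiffOn_mulVec_dotProduct
    (((contDiffOn_adjugateMatrix (contDiffOn_gramIn g x₀) (contDiffOn_gramIn g' x₀)
      (fun q hq ↦ det_gramIn_pos g hq) (fun q hq ↦ det_gramIn_pos g' hq) t).mul
      (contDiffOn_matrix_inv (contDiffOn_gramIn g x₀) fun q hq ↦ det_gramIn_pos g hq)).comp
        (contDiffOn_fst (F := Model n →L[ℝ] ℝ)) fun (_ : Model n × (Model n →L[ℝ] ℝ)) hz ↦ hz.1)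
    -- The second matrix is the identity.
    (contDiffOn_const (c := 1)) hp hp
  simp only [Matrix.one_mulVec] at h1
  exact (h1.contDiffAt (hU.mem_nhds ⟨hz, trivial⟩)).differentiableAt (by simp)

/-- The derivative in the momenta: `I_t` is a quadratic form in the covector, with symmetric matrix
`S_t g⁻¹`. -/
theorem fderiv_hamiltonian_momentum (g g' : Metric n M) {x₀ : M} (t : ℝ)
    {z : Model n × (Model n →L[ℝ] ℝ)} (hz : z.1 ∈ (extChartAt (𝓡 n) x₀).target)
    (p : Model n →L[ℝ] ℝ) :
    fderiv ℝ (hamiltonian g g' x₀ t) z (0, p)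
      = 2 * ((adjugateMatrix (gramIn g x₀ z.1) (gramIn g' x₀ z.1) t
          *ᵥ ((gramIn g x₀ z.1)⁻¹ *ᵥ covectorCoeff z.2)) ⬝ᵥ covectorCoeff p) := by
  have hl := (differentiableAt_hamiltonian g g' t hz).hasFDerivAt.hasLineDerivAt (0, p)
  have hp : HasDerivAt (fun r : ℝ ↦ covectorCoeff z.2 + r • covectorCoeff p)
      (covectorCoeff p) 0 := by
    have h := ((hasDerivAt_id (0 : ℝ)).smul_const (covectorCoeff p)).const_add (covectorCoeff z.2)
    rwa [one_smul] at h
  set K := adjugateMatrix (gramIn g x₀ z.1) (gramIn g' x₀ z.1) t * (gramIn g x₀ z.1)⁻¹ with hK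
  have h2 := hasDerivAt_dotProduct (hasDerivAt_mulVec (hasDerivAt_const (0 : ℝ) K) hp) hp
  have h3 := h2.congr_of_eventuallyEq (f₁ := fun r : ℝ ↦ hamiltonian g g' x₀ t (z + r • (0, p)))
    (Filter.Eventually.of_forall fun r ↦ by simp [hamiltonian, hK])
  have hr : gramIn g x₀ z.1 * (gramIn g x₀ z.1)⁻¹ = 1 :=
    Matrix.mul_nonsing_inv _ (det_gramIn_pos g hz).ne'.isUnit
  have hS := selfAdjoint_adjugateMatrix (transpose_gramIn g x₀ z.1) (transpose_gramIn g' x₀ z.1) t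
  have hsymm : ∀ a b : Fin n → ℝ, (K *ᵥ a) ⬝ᵥ b = (K *ᵥ b) ⬝ᵥ a := by
    intro a b
    have h4 : ∀ b : Fin n → ℝ, b = gramIn g x₀ z.1 *ᵥ ((gramIn g x₀ z.1)⁻¹ *ᵥ b) := fun b ↦ by
      rw [Matrix.mulVec_mulVec, hr, Matrix.one_mulVec]
    rw [hK, ← Matrix.mulVec_mulVec, ← Matrix.mulVec_mulVec]
    conv_lhs => rw [h4 b]
    conv_rhs => rw [h4 a]
    rw [← dotProduct_mulVec_of_selfAdjoint (transpose_gramIn g x₀ z.1) hS,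
      dotProduct_mulVec_symm (transpose_gramIn g x₀ z.1)]
  rw [HasDerivAt.unique hl h3]
  simp only [zero_smul, add_zero, Matrix.zero_mulVec, zero_add]
  rw [hsymm (covectorCoeff p), hK, Matrix.mulVec_mulVec]
  ring

/-- The derivative in the positions, in terms of the vector `v` dual to the covector. -/
theorem fderiv_hamiltonian_position (g g' : Metric n M) {x₀ : M} (t : ℝ)
    {z : Model n × (Model n →L[ℝ] ℝ)} (hz : z.1 ∈ (extChartAt (𝓡 n) x₀).target)
    {φ : Fin n → ℝ} (w : Model n)
    (hφ : connectionMatrix g' x₀ z.1 w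
      = connectionMatrix g x₀ z.1 w + (φ ⬝ᵥ w.ofLp) • (1 : Matrix (Fin n) (Fin n) ℝ)
        + vecMulVec w.ofLp φ)
    {v : Fin n → ℝ} (hv : (gramIn g x₀ z.1)⁻¹ *ᵥ covectorCoeff z.2 = v) :
    fderiv ℝ (hamiltonian g g' x₀ t) z (w, 0)
      = (adjugateDeriv (benentiMatrix (gramIn g x₀ z.1) (gramIn g' x₀ z.1) - t • 1)
          (sinjukov (gramIn g x₀ z.1)
            (-((benentiMatrix (gramIn g x₀ z.1) (gramIn g' x₀ z.1))ᵀ *ᵥ φ)) w.ofLp) *ᵥ v)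
            ⬝ᵥ (gramIn g x₀ z.1 *ᵥ v)
        - 2 * ((connectionMatrix g x₀ z.1 w
            *ᵥ (adjugateMatrix (gramIn g x₀ z.1) (gramIn g' x₀ z.1) t *ᵥ v))
            ⬝ᵥ (gramIn g x₀ z.1 *ᵥ v)) := by
  have hl := (differentiableAt_hamiltonian g g' t hz).hasFDerivAt.hasLineDerivAt (w, 0)
  have hc : HasDerivAt (fun r : ℝ ↦ z.1 + r • w) w 0 := by
    have h := ((hasDerivAt_id (0 : ℝ)).smul_const w).const_add z.1
    rwa [one_smul] at h
  have h0 : z.1 + (0 : ℝ) • w = z.1 := by simp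
  have hq : z.1 + (0 : ℝ) • w ∈ (extChartAt (𝓡 n) x₀).target := by rwa [h0]
  have hG := hasDerivAt_gramIn g hq hc
  have hG' := hasDerivAt_gramIn g' hq hc
  have h := hasDerivAt_integralForm_covector (φ := φ) (w := w.ofLp)
    (p := covectorCoeff z.2) (v := v)
    (C := connectionMatrix g x₀ (z.1 + (0 : ℝ) • w) w)
    (C' := connectionMatrix g' x₀ (z.1 + (0 : ℝ) • w) w)
    hG hG' (by rwa [h0]) (transpose_gramIn g x₀ _) (transpose_gramIn g' x₀ _) (det_gramIn_pos g hq)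
    (det_gramIn_pos g' hq) (by rwa [h0]) t
  have h3 := h.congr_of_eventuallyEq (f₁ := fun r : ℝ ↦ hamiltonian g g' x₀ t (z + r • (w, 0)))
    (Filter.Eventually.of_forall fun r ↦ by simp [hamiltonian])
  rw [HasDerivAt.unique hl h3, h0]

/-- One half of the Poisson bracket, as a derivative along the velocity of the second function. -/
theorem sum_fderiv_hamiltonian (g g' : Metric n M) {x₀ : M} (a b : ℝ)
    {z : Model n × (Model n →L[ℝ] ℝ)} (hz : z.1 ∈ (extChartAt (𝓡 n) x₀).target) :
    ∑ i, fderiv ℝ (hamiltonian g g' x₀ a) z (EuclideanSpace.single i 1, 0)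
        * fderiv ℝ (hamiltonian g g' x₀ b) z (0, EuclideanSpace.proj i)
      = 2 * fderiv ℝ (hamiltonian g g' x₀ a) z
        (WithLp.toLp 2 (adjugateMatrix (gramIn g x₀ z.1) (gramIn g' x₀ z.1) b
          *ᵥ ((gramIn g x₀ z.1)⁻¹ *ᵥ covectorCoeff z.2)), 0) := by
  set y := adjugateMatrix (gramIn g x₀ z.1) (gramIn g' x₀ z.1) b
    *ᵥ ((gramIn g x₀ z.1)⁻¹ *ᵥ covectorCoeff z.2) with hy
  have h1 : ∀ i, fderiv ℝ (hamiltonian g g' x₀ b) z (0, EuclideanSpace.proj i) = 2 * y i := by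
    intro i
    rw [fderiv_hamiltonian_momentum g g' b hz, ← hy]
    have h2 : covectorCoeff (EuclideanSpace.proj i : Model n →L[ℝ] ℝ) = Pi.single i 1 := by
      ext j
      simp [covectorCoeff_apply, Pi.single_apply, eq_comm]
    rw [h2, dotProduct_single, mul_one]
  have h2 : ((WithLp.toLp 2 y : Model n), (0 : Model n →L[ℝ] ℝ))
      = ∑ i, y i • ((EuclideanSpace.single i 1 : Model n), (0 : Model n →L[ℝ] ℝ)) := by
    ext1
    · simp only [Prod.fst_sum, Prod.smul_fst]
      exact (sum_smul_single (WithLp.toLp 2 y)).symm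
    · simp [Prod.snd_sum]
  rw [h2, map_sum, Finset.mul_sum]
  refine Finset.sum_congr rfl fun i _ ↦ ?_
  rw [h1, map_smul, smul_eq_mul]
  ring

/-- The bracket is twice the difference of the derivatives of `I_a` along `S_b v` and of `I_b` along
`S_a v`. The connection terms cancel by the symmetry of the connection, and the remaining terms by
`quadratic_adjugateDeriv_comm`. -/
theorem poissonCommute_integral {g g' : Metric n M} (h : GeodesicallyEquivalent g g') (a b : ℝ) :
    PoissonCommute g (integral g g' a) (integral g g' b) := by
  intro v x₀ hx
  have hz : (cotangentCoord x₀ (flat g v)).1 ∈ (extChartAt (𝓡 n) x₀).target := coord_mem_target hx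
  generalize hzdef : cotangentCoord x₀ (flat g v) = z at hz
  have hev : ∀ t, fderiv ℝ ((integral g g' t ∘ sharp g) ∘ cotangentCoordInv x₀) z
      = fderiv ℝ (hamiltonian g g' x₀ t) z := by
    intro t
    refine Filter.EventuallyEq.fderiv_eq ?_
    filter_upwards [continuousAt_fst.preimage_mem_nhds
      ((isOpen_extChartAt_target x₀).mem_nhds hz)] with z' hz'
    exact integral_sharp_cotangentCoordInv g g' t hz'
  rw [cotangentBracket, hzdef]
  simp only [partialQ, partialP, hev]
  rw [Finset.sum_sub_distrib, sum_fderiv_hamiltonian g g' a b hz]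
  simp only [mul_comm (fderiv ℝ (hamiltonian g g' x₀ a) z (0, _))]
  rw [sum_fderiv_hamiltonian g g' b a hz]
  obtain ⟨φ, hφ⟩ := h.exists_connectionMatrix_eq hz
  rw [fderiv_hamiltonian_position g g' a hz _ (hφ _) rfl,
    fderiv_hamiltonian_position g g' b hz _ (hφ _) rfl]
  have hG := transpose_gramIn g x₀ z.1
  have hcomm := quadratic_adjugateDeriv_comm hG (det_gramIn_pos g hz).ne'
    (selfAdjoint_benentiMatrix hG (transpose_gramIn g' x₀ z.1)) a b
    (-((benentiMatrix (gramIn g x₀ z.1) (gramIn g' x₀ z.1))ᵀ *ᵥ φ))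
    ((gramIn g x₀ z.1)⁻¹ *ᵥ covectorCoeff z.2)
  -- The symmetry `Γ(S_b v, S_a v) = Γ(S_a v, S_b v)`.
  have hsymm := connectionMatrix_symm g hz
    (WithLp.toLp 2 (adjugateMatrix (gramIn g x₀ z.1) (gramIn g' x₀ z.1) b
      *ᵥ ((gramIn g x₀ z.1)⁻¹ *ᵥ covectorCoeff z.2)))
    (WithLp.toLp 2 (adjugateMatrix (gramIn g x₀ z.1) (gramIn g' x₀ z.1) a
      *ᵥ ((gramIn g x₀ z.1)⁻¹ *ᵥ covectorCoeff z.2)))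
  simp only at hsymm
  rw [hsymm]
  simp only [adjugateMatrix] at hcomm ⊢
  rw [hcomm]
  ring

end Poisson
end GeodesicEquivalence

theorem theorem4 {n : ℕ} (hn : 2 ≤ n) {M : Type*} [TopologicalSpace M]
    [ChartedSpace (EuclideanSpace ℝ (Fin n)) M] [IsManifold (𝓡 n) ∞ M]
    (g g' : GeodesicEquivalence.Metric n M)
    (h : GeodesicEquivalence.GeodesicallyEquivalent g g') :
    (∀ t : ℝ, GeodesicEquivalence.IsGeodesicIntegral g (GeodesicEquivalence.integral g g' t)) ∧
    (∀ t₁ t₂ : ℝ, GeodesicEquivalence.PoissonCommute g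
      (GeodesicEquivalence.integral g g' t₁) (GeodesicEquivalence.integral g g' t₂)) :=
  ⟨GeodesicEquivalence.isGeodesicIntegral_integral h,
    GeodesicEquivalence.poissonCommute_integral h⟩
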